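/- Let $(W,H,\mu)$ be an abstract Wiener space: $W$ is a separable Banach space, $H$ is a Hilbert space continuously and densely embedded in $W$, and every $\varphi\in W^*\subset H^*=H$ has law $N(0,|\varphi|_H^2)$ under $\mu$. For $h\in H$ let $\delta(h)\in L^2(\mu)$ be the $L^2$-limit of $\varphi_n(w)$ for $\varphi_n\in W^*$, $\varphi_n\to h$ in $H$. Let $\mathbb D_{2,1}(H)$ be the domain in $L^2(\mu;H)$ of the closure $\nabla$ of the gradient $\sum_j f_j(\delta(h_1),\dots,\delta(h_n))x_j\mapsto\sum_{i,j}\partial_i f_j(\delta(h_1),\dots,\delta(h_n))\,x_j\otimes h_i$ on smooth cylindrical functionals, with values in $L^2(\mu;H\otimes H)$; $x\otimes h$ is identified with the Hilbert–Schmidt operator $k\mapsto (h,k)_H\,x$. A Hilbert–Schmidt operator $T$ is called quasinilpotent if $\|T^n\|^{1/n}\to0$. A continuous strictly increasing resolution of the identity is a family $(\pi_\theta)_{0\le\theta\le1}$ of orthogonal projections on $H$ with strictly increasing ranges, $\pi_0=0$, $\pi_1=I$, and $\theta\mapsto\pi_\theta h$ continuous for every $h\in H$. It induces the filtration $\mathcal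 F_\theta=\sigma\{\delta(\pi_\theta h):h\in H\}$, and an $H$-valued random variable $v$ is adapted to it if $(v,\pi_\theta h)_H$ is $\mathcal F_\theta$-measurable (up to a.s. equality) for all $\theta\in[0,1]$ and $h\in H$. Let $(e_i)_{i\ge1}$ be a complete orthonormal basis of $H$, let $\alpha>0$, and set $$u=\sum_{i=1}^\infty 2^{-i\alpha}\,\delta(e_{i+1})\,e_i .$$ Then the series converges a.s. in $H$; $u\in\mathbb D_{2,1}(H)$; almost surely $\nabla u$ is the weighted shift $(\nabla u)h=\sum_{i=1}^\infty 2^{-i\alpha}(e_{i+1},h)_H\,e_i$ for all $h\in H$, and it is quasinilpotent. Nevertheless, there is no continuous strictly increasing resolution of the identity on $H$ such that $u$ is adapted to the filtration it induces. Consequently the converse of "$v$ adapted $\Rightarrow\nabla v$ a.s. quasinilpotent" fails: it is not true that every $v\in\mathbb D_{2,1}(H)$ whose gradient is a.s. quasinilpotent is adapted to the filtration induced by some continuous strictly increasing resolution of the identity. -/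

import Mathlib

open MeasureTheory ProbabilityTheory Filter Topology
open scoped ENNReal NNReal InnerProductSpace

noncomputable section

/-- An abstract Wiener space `(W, H, μ)`: the Hilbert space `H` is continuously and densely embedded
in the Banach space `W` by `ι`, and every `φ` in the dual of `W` has under `μ` the law
`N(0, |φ|_H ^ 2)`, where `|φ|_H` is the norm of `φ` restricted to `H`, an element of `H* = H`. -/
structure AbstractWienerSpace (W H : Type*) [NormedAddCommGroup W] [NormedSpace ℝ W]
    [MeasurableSpace W] [NormedAddCommGroup H] [InnerProductSpace ℝ H] where
  ι : H →L[ℝ] W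
  injective_ι : Function.Injective ι
  denseRange_ι : DenseRange ι
  μ : Measure W
  isProbabilityMeasure : IsProbabilityMeasure μ
  map_dual : ∀ φ : StrongDual ℝ W, μ.map φ = gaussianReal 0 (‖φ.comp ι‖₊ ^ 2)

/-- The square of the Hilbert-Schmidt norm of `T`, in `[0, ∞]`. By Bessel and Parseval the supremum
is the usual sum of `‖T b‖ ^ 2` over the vectors `b` of any orthonormal basis. -/
def hsNormSq {H X : Type*} [NormedAddCommGroup H] [InnerProductSpace ℝ H]
    [NormedAddCommGroup X] [InnerProductSpace ℝ X] (T : H →L[ℝ] X) : ℝ≥0∞ :=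
  ⨆ (s : Finset H) (_ : Orthonormal ℝ (fun x : s => (x : H))), ∑ x ∈ s, ‖T x‖ₑ ^ 2

/-- A quasinilpotent Hilbert-Schmidt operator: `‖T ^ n‖ ^ (1 / n) → 0` (operator norm). -/
def IsQuasinilpotent {H : Type*} [NormedAddCommGroup H] [InnerProductSpace ℝ H]
    (T : H →L[ℝ] H) : Prop :=
  hsNormSq T < ∞ ∧ Tendsto (fun n : ℕ => ‖T ^ n‖ ^ (1 / (n : ℝ))) atTop (𝓝 0)

/-- A continuous strictly increasing resolution of the identity `π_θ`, `0 ≤ θ ≤ 1`, on `H`: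
orthogonal projections with strictly increasing ranges, `π_0 = 0`, `π_1 = 1`, strongly continuous
in `θ`. -/
structure ContinuousResolution (H : Type*) [NormedAddCommGroup H] [InnerProductSpace ℝ H]
    [CompleteSpace H] where
  proj : Set.Icc (0 : ℝ) 1 → H →L[ℝ] H
  isStarProjection : ∀ θ, IsStarProjection (proj θ)
  strictMono_range : StrictMono (fun θ => (proj θ).range)
  proj_zero : proj 0 = 0
  proj_one : proj 1 = 1
  continuous_apply : ∀ h, Continuous (fun θ => proj θ h)

namespace AbstractWienerSpace

section
variable {W H : Type*} [NormedAddCommGroup W] [NormedSpace ℝ W] [MeasurableSpace W] [BorelSpace W]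
  [NormedAddCommGroup H] [InnerProductSpace ℝ H]

instance (A : AbstractWienerSpace W H) : IsProbabilityMeasure A.μ := A.isProbabilityMeasure

theorem memLp_dual (A : AbstractWienerSpace W H) (φ : StrongDual ℝ W) :
    MemLp (fun w => φ w) 2 A.μ := by
  have h : MemLp id 2 (A.μ.map φ) := by
    rw [A.map_dual]; exact memLp_id_gaussianReal 2
  exact (memLp_map_measure_iff (f := fun w => φ w) (by fun_prop) (by fun_prop)).1 h

/-- A continuous linear functional on `W` as an element of `L²(μ)`. -/
def dualToLp (A : AbstractWienerSpace W H) : StrongDual ℝ W →ₗ[ℝ] Lp ℝ 2 A.μ where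
  toFun φ := (A.memLp_dual φ).toLp
  map_add' _ _ := rfl
  map_smul' _ _ := rfl

variable [CompleteSpace H]

/-- The embedding of the dual of `W` into `H* = H`. -/
def dualToH (A : AbstractWienerSpace W H) : StrongDual ℝ W →ₗ[ℝ] H where
  toFun φ := (InnerProductSpace.toDual ℝ H).symm (φ.comp A.ι)
  map_add' φ ψ := by simp
  map_smul' c φ := by simp

/-- `δ(h)`, as an element of `L²(μ)`: the continuous extension to `H` of `φ ↦ φ(w)`, which is an
isometry from the dual of `W`, with the norm of `H`, into `L²(μ)`. -/
def delta (A : AbstractWienerSpace W H) : H →L[ℝ] Lp ℝ 2 A.μ :=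
  A.dualToLp.extendOfNorm A.dualToH

theorem norm_dualToLp (A : AbstractWienerSpace W H) (φ : StrongDual ℝ W) :
    ‖A.dualToLp φ‖ = ‖A.dualToH φ‖ := by
  have h1 : ‖A.dualToLp φ‖ ^ 2 = ∫ w, (φ w) ^ 2 ∂A.μ := by
    have h := A.memLp_dual φ
    rw [← real_inner_self_eq_norm_sq, L2.inner_def]
    apply integral_congr_ae
    filter_upwards [h.coeFn_toLp] with w hw
    change ⟪(h.toLp) w, (h.toLp) w⟫_ℝ = _
    rw [hw]; simp [sq]
  have h2 : ∫ w, (φ w) ^ 2 ∂A.μ = ‖φ.comp A.ι‖ ^ 2 := by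
    have h := variance_fun_id_gaussianReal (μ := 0) (v := ‖φ.comp A.ι‖₊ ^ 2)
    rw [variance_of_integral_eq_zero (by fun_prop) (by simp), ← A.map_dual,
      integral_map (by fun_prop) (by fun_prop)] at h
    simpa using h
  have h3 : ‖A.dualToH φ‖ = ‖φ.comp A.ι‖ := by
    simp [dualToH]
  rw [← h3, ← h1] at h2
  exact (sq_eq_sq₀ (norm_nonneg _) (norm_nonneg _)).1 (h1.trans (h1.symm.trans h2))

theorem denseRange_dualToH (A : AbstractWienerSpace W H) : DenseRange A.dualToH := by
  have h : (A.dualToH.range)ᗮ = ⊥ := by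
    rw [Submodule.eq_bot_iff]
    intro x hx
    apply A.injective_ι
    rw [map_zero]
    apply SeparatingDual.eq_zero_of_forall_dual_eq_zero (R := ℝ)
    intro φ
    have := (Submodule.mem_orthogonal _ _).1 hx (A.dualToH φ) ⟨φ, rfl⟩
    simpa [dualToH] using this
  rw [← Submodule.topologicalClosure_eq_top_iff] at h
  exact Submodule.dense_iff_topologicalClosure_eq_top.2 h

/-- On the dual of `W`, `δ` is evaluation. -/
theorem delta_dualToH (A : AbstractWienerSpace W H) (φ : StrongDual ℝ W) :
    A.delta (A.dualToH φ) =ᵐ[A.μ] fun w => φ w := by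
  rw [delta, LinearMap.extendOfNorm_eq A.denseRange_dualToH
    ⟨1, fun φ => by rw [one_mul, norm_dualToLp]⟩]
  exact (A.memLp_dual φ).coeFn_toLp

theorem norm_delta (A : AbstractWienerSpace W H) (h : H) : ‖A.delta h‖ = ‖h‖ := by
  refine A.denseRange_dualToH.induction_on (p := fun h => ‖A.delta h‖ = ‖h‖) h
    (isClosed_eq (by fun_prop) (by fun_prop)) fun φ => ?_
  rw [delta, LinearMap.extendOfNorm_eq A.denseRange_dualToH
    ⟨1, fun φ => by rw [one_mul, norm_dualToLp]⟩, norm_dualToLp]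

end

end AbstractWienerSpace

/-- The data of a smooth cylindrical `X`-valued functional
`F = ∑_{j < m} f_j(δ(h_0), …, δ(h_{n-1})) x_j`, where each `f_j` is smooth with all derivatives of
polynomial growth. -/
structure SmoothCylinder (H X : Type*) where
  n : ℕ
  m : ℕ
  dir : Fin n → H
  coeff : Fin m → (Fin n → ℝ) → ℝ
  temperate : ∀ j, (coeff j).HasTemperateGrowth
  vec : Fin m → X

namespace AbstractWienerSpace

variable {W H X : Type*} [NormedAddCommGroup W] [NormedSpace ℝ W] [MeasurableSpace W] [BorelSpace W]
  [NormedAddCommGroup H] [InnerProductSpace ℝ H] [CompleteSpace H]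
  [NormedAddCommGroup X] [InnerProductSpace ℝ X]

/-- The value of a smooth cylindrical functional. -/
def cylinderEval (A : AbstractWienerSpace W H) (F : SmoothCylinder H X) (w : W) : X :=
  ∑ j, F.coeff j (fun i => A.delta (F.dir i) w) • F.vec j

/-- The gradient of a smooth cylindrical functional, as an operator from `H` to `X`:
`(∇F) k = ∑_j (∑_i (∂_i f_j)(δ(h_0), …, δ(h_{n-1})) (h_i, k)) x_j`. -/
def cylinderGrad (A : AbstractWienerSpace W H) (F : SmoothCylinder H X) (w : W) : H →L[ℝ] X :=
  ∑ j, (∑ i, fderiv ℝ (F.coeff j) (fun l => A.delta (F.dir l) w) (Pi.single i 1) •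
    innerSL ℝ (F.dir i)).smulRight (F.vec j)

/-- `u` lies in the Sobolev space `𝔻_{2,1}(X)` and `G` is (a version of) its gradient `∇u`, where
`∇ : L²(μ; X) → L²(μ; X ⊗ H)` is the closure of the gradient on smooth cylindrical functionals and
`X ⊗ H` is the space of Hilbert-Schmidt operators from `H` to `X`. -/
structure IsGradient (A : AbstractWienerSpace W H) (u : W → X) (G : W → H →L[ℝ] X) : Prop where
  memLp : MemLp u 2 A.μ
  aestronglyMeasurable : ∀ h, AEStronglyMeasurable (fun w => G w h) A.μ
  lintegral_lt_top : ∫⁻ w, hsNormSq (G w) ∂A.μ < ∞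
  exists_approx : ∃ F : ℕ → SmoothCylinder H X,
    Tendsto (fun n => eLpNorm (fun w => A.cylinderEval (F n) w - u w) 2 A.μ) atTop (𝓝 0) ∧
    Tendsto (fun n => ∫⁻ w, hsNormSq (A.cylinderGrad (F n) w - G w) ∂A.μ) atTop (𝓝 0)

/-- `u` lies in the Sobolev space `𝔻_{2,1}(X)`. -/
def MemD21 (A : AbstractWienerSpace W H) (u : W → X) : Prop :=
  ∃ G : W → H →L[ℝ] X, A.IsGradient u G

/-- The gradient of `u` is almost surely quasinilpotent (for every version of the gradient). -/
def HasQuasinilpotentGradient (A : AbstractWienerSpace W H) (u : W → H) : Prop :=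
  ∀ G : W → H →L[ℝ] H, A.IsGradient u G → ∀ᵐ w ∂A.μ, IsQuasinilpotent (G w)

/-- The σ-algebra `F_θ = σ{δ(π_θ h) : h ∈ H}`. -/
@[reducible]
def filtration (A : AbstractWienerSpace W H) (π : ContinuousResolution H)
    (θ : Set.Icc (0 : ℝ) 1) : MeasurableSpace W :=
  ⨆ h : H, MeasurableSpace.comap (A.delta (π.proj θ h)) (borel ℝ)

/-- `u` is adapted to the filtration induced by `π`: for all `θ` and `h`, `(u, π_θ h)` is
`F_θ`-measurable. Random variables being identified when they are a.s. equal, this means a.s.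
equality with an `F_θ`-measurable function. -/
def IsAdapted (A : AbstractWienerSpace W H) (π : ContinuousResolution H) (u : W → H) : Prop :=
  ∀ θ h, AEStronglyMeasurable[A.filtration π θ] (fun w => ⟪u w, π.proj θ h⟫_ℝ) A.μ

/-- The functional `u = ∑_{i ≥ 1} 2^{-iα} δ(e_{i+1}) e_i`. Lean counts from `0`: the vectors
`e_1, e_2, …` are `e 0, e 1, …`. -/
def shiftField (A : AbstractWienerSpace W H) (e : HilbertBasis ℕ ℝ H) (α : ℝ) (w : W) : H :=
  ∑' i : ℕ, ((2 : ℝ) ^ (-((i : ℝ) + 1) * α) * A.delta (e (i + 1)) w) • e i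

end AbstractWienerSpace

end

/-! Put `q = 2 ^ (-α) < 1` and let `B` be `backwardShift e q`, so that `B e_{i+1} = q^{i+1} e_i` and
`B e_0 = 0`. The field `u` is linear in the Gaussian variables. Its partial sums are smooth
cylinders with deterministic gradients, and these converge in Hilbert–Schmidt norm to `B`
(`isGradient_shiftField`). The weights multiply along powers, so `‖B^n‖ ≤ q^{n(n+1)/2}` and `B` is
quasinilpotent.

Adaptedness would force invariant subspaces on `B`. Almost surely `(u, x) = δ(B* x)`
(`inner_shiftField_ae_eq`). A variable `δ(v)` is `F_θ`-measurable only if `v` lies in the range of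
`π_θ`, since the part of `v` orthogonal to this range gives a variable independent of `F_θ`
(`proj_eq_self_of_aestronglyMeasurable`). Hence `B*` preserves each range, and `B` preserves each
kernel. But `B` is a Donoghue shift: a closed invariant subspace other than `0` contains `e_0`
(`eq_zero_of_forall_backwardShift_mem_ker`). So each `π_θ` either kills `e_0` or is injective, hence
the identity, and `‖π_θ e_0‖` takes only the values 0 and 1. Continuity in `θ` from 0 to 1 forbids
this.

The claims about the gradient concern every version of it, so closability is also needed. Gaussian
integration by parts determines the integrals of `(G k, x)` against cosines and sines of functionals
in the dual of `W`, and uniqueness of characteristic functionals then determines `G` almost surely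
(`IsGradient.ae_eq`). -/

/-! ### Joint Gaussian law of the variables `δ(h)` -/

theorem integral_norm_le_norm_Lp {Ω : Type*} [MeasurableSpace Ω] {μ : Measure Ω}
    [IsProbabilityMeasure μ] (f : Lp ℝ 2 μ) : ∫ w, ‖f w‖ ∂μ ≤ ‖f‖ := by
  have hf := Lp.memLp f
  rw [integral_norm_eq_lintegral_enorm hf.1, ← eLpNorm_one_eq_lintegral_enorm, Lp.norm_def]
  exact ENNReal.toReal_mono (Lp.eLpNorm_ne_top f)
    (eLpNorm_le_eLpNorm_of_exponent_le (by norm_num) hf.1)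

/-- Since `|exp(ia) - exp(ib)| ≤ |a - b|`, the map is Lipschitz with constant `|t|`. This carries
the characteristic function from the dual of `W` to all of `H`. -/
theorem continuous_integral_exp {Ω : Type*} [MeasurableSpace Ω] {μ : Measure Ω}
    [IsProbabilityMeasure μ] (t : ℝ) :
    Continuous fun f : Lp ℝ 2 μ => ∫ w, Complex.exp (t * f w * Complex.I) ∂μ := by
  have hint : ∀ f : Lp ℝ 2 μ, Integrable (fun w => Complex.exp (t * f w * Complex.I)) μ := by
    intro f
    refine Integrable.of_bound (C := 1) ?_ (ae_of_all _ fun w => ?_)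
    · have := (Lp.stronglyMeasurable f).measurable
      exact Measurable.aestronglyMeasurable (by fun_prop)
    · rw [← Complex.ofReal_mul, Complex.norm_exp_ofReal_mul_I]
  refine (LipschitzWith.of_dist_le_mul (K := ‖t‖₊) fun f g => ?_).continuous
  rw [dist_eq_norm, ← integral_sub (hint f) (hint g)]
  calc ‖∫ w, (Complex.exp (t * f w * Complex.I) - Complex.exp (t * g w * Complex.I)) ∂μ‖
      ≤ ∫ w, |t| * ‖(f - g) w‖ ∂μ := by
        refine norm_integral_le_of_norm_le
          (((Lp.memLp (f - g)).integrable (by norm_num)).norm.const_mul _) ?_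
        filter_upwards [Lp.coeFn_sub f g] with w hw
        rw [hw, Pi.sub_apply]
        have h1 : Complex.exp (t * f w * Complex.I) - Complex.exp (t * g w * Complex.I) =
            Complex.exp (((t * g w : ℝ) : ℂ) * Complex.I) *
              (Complex.exp (Complex.I * ((t * (f w - g w) : ℝ) : ℂ)) - 1) := by
          rw [mul_sub, ← Complex.exp_add]
          push_cast
          ring_nf
        rw [h1, norm_mul, Complex.norm_exp_ofReal_mul_I, one_mul, Real.norm_eq_abs, ← abs_mul,
          ← Real.norm_eq_abs]
        exact Real.norm_exp_I_mul_ofReal_sub_one_le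
    _ = |t| * ∫ w, ‖(f - g) w‖ ∂μ := integral_const_mul _ _
    _ ≤ _ := by
        rw [dist_eq_norm]
        exact mul_le_mul_of_nonneg_left (integral_norm_le_norm_Lp _) (abs_nonneg t)

namespace AbstractWienerSpace

variable {W H : Type*} [NormedAddCommGroup W] [NormedSpace ℝ W] [MeasurableSpace W] [BorelSpace W]
  [NormedAddCommGroup H] [InnerProductSpace ℝ H] [CompleteSpace H]

theorem measurable_delta (A : AbstractWienerSpace W H) (h : H) : Measurable (A.delta h) :=
  (Lp.stronglyMeasurable _).measurable

theorem delta_add (A : AbstractWienerSpace W H) (h k : H) :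
    A.delta (h + k) =ᵐ[A.μ] fun w => A.delta h w + A.delta k w := by
  rw [map_add]
  exact Lp.coeFn_add _ _

theorem delta_smul (A : AbstractWienerSpace W H) (c : ℝ) (h : H) :
    A.delta (c • h) =ᵐ[A.μ] fun w => c * A.delta h w := by
  rw [map_smul]
  exact Lp.coeFn_smul _ _

theorem delta_sum (A : AbstractWienerSpace W H) {ι : Type*} (s : Finset ι) (c : ι → ℝ)
    (h : ι → H) :
    A.delta (∑ i ∈ s, c i • h i) =ᵐ[A.μ] fun w => ∑ i ∈ s, c i * A.delta (h i) w := by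
  classical
  induction s using Finset.induction_on with
  | empty =>
    simp only [Finset.sum_empty, map_zero]
    exact Lp.coeFn_zero _ _ _
  | insert a s ha ih =>
    rw [Finset.sum_insert ha]
    filter_upwards [A.delta_add (c a • h a) (∑ i ∈ s, c i • h i), ih, A.delta_smul (c a) (h a)]
      with w h1 h2 h3
    rw [h1, h2, h3, Finset.sum_insert ha]

theorem inner_delta (A : AbstractWienerSpace W H) (h k : H) :
    ⟪A.delta h, A.delta k⟫_ℝ = ⟪h, k⟫_ℝ :=
  LinearIsometry.inner_map_map ⟨(A.delta : H →ₗ[ℝ] Lp ℝ 2 A.μ), A.norm_delta⟩ h k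

theorem integral_delta_mul_delta (A : AbstractWienerSpace W H) (h k : H) :
    ∫ w, A.delta h w * A.delta k w ∂A.μ = ⟪h, k⟫_ℝ := by
  rw [← A.inner_delta, L2.inner_def]
  simp [mul_comm]

theorem memLp_delta (A : AbstractWienerSpace W H) (h : H) : MemLp (A.delta h) 2 A.μ :=
  Lp.memLp _

/-- Both sides are continuous in `h`, and on the dense image of the dual of `W` the formula is the
hypothesis `map_dual`. -/
theorem integral_exp_delta (A : AbstractWienerSpace W H) (t : ℝ) (h : H) :
    ∫ w, Complex.exp (t * A.delta h w * Complex.I) ∂A.μ =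
      Complex.exp (-((‖h‖ ^ 2 * t ^ 2 / 2 : ℝ) : ℂ)) := by
  refine A.denseRange_dualToH.induction_on
    (p := fun h => ∫ w, Complex.exp (t * A.delta h w * Complex.I) ∂A.μ =
      Complex.exp (-((‖h‖ ^ 2 * t ^ 2 / 2 : ℝ) : ℂ))) h
    (isClosed_eq ((continuous_integral_exp t).comp A.delta.continuous) (by fun_prop)) fun φ => ?_
  have h1 : ∫ w, Complex.exp (t * A.delta (A.dualToH φ) w * Complex.I) ∂A.μ =
      charFun (A.μ.map φ) t := by
    rw [charFun_apply_real, integral_map (by fun_prop) (by fun_prop)]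
    refine integral_congr_ae ?_
    filter_upwards [A.delta_dualToH φ] with w hw
    rw [hw]
  rw [h1, A.map_dual, charFun_gaussianReal]
  simp [dualToH]

theorem map_delta (A : AbstractWienerSpace W H) (h : H) :
    A.μ.map (A.delta h) = gaussianReal 0 (‖h‖₊ ^ 2) := by
  have := Measure.isProbabilityMeasure_map (μ := A.μ) (A.measurable_delta h).aemeasurable
  refine Measure.ext_of_charFun ?_
  ext t
  rw [charFun_apply_real, integral_map (A.measurable_delta h).aemeasurable (by fun_prop),
    A.integral_exp_delta, charFun_gaussianReal]
  simp

theorem integral_delta (A : AbstractWienerSpace W H) (h : H) : ∫ w, A.delta h w ∂A.μ = 0 := by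
  have h1 := integral_map (μ := A.μ) (A.measurable_delta h).aemeasurable
    (f := fun x : ℝ => x) (by fun_prop)
  rw [← h1, A.map_delta]
  simp

/-- A linear functional of the vector is a.s. `δ` of one linear combination of the `h i`, so
`map_delta` gives its law. -/
theorem hasGaussianLaw_delta_pi (A : AbstractWienerSpace W H) {ι : Type*} [Fintype ι]
    (h : ι → H) : HasGaussianLaw (fun w i => A.delta (h i) w) A.μ := by
  classical
  have hm : Measurable fun w i => A.delta (h i) w := measurable_pi_lambda _ fun i =>
    A.measurable_delta (h i)
  refine ⟨isGaussian_of_map_eq_gaussianReal fun L => ⟨0, ‖∑ i, L (Pi.single i 1) • h i‖₊ ^ 2, ?_⟩⟩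
  rw [Measure.map_map (by fun_prop) hm, ← A.map_delta]
  refine Measure.map_congr ?_
  filter_upwards [A.delta_sum Finset.univ (fun i => L (Pi.single i 1)) h] with w hw
  rw [hw, Function.comp_apply]
  conv_lhs => rw [← Finset.univ_sum_single (fun i => A.delta (h i) w), map_sum]
  refine Finset.sum_congr rfl fun i _ => ?_
  rw [mul_comm, ← smul_eq_mul, ← map_smul, ← Pi.single_smul, smul_eq_mul, mul_one]

theorem isGaussianProcess_delta (A : AbstractWienerSpace W H) :
    IsGaussianProcess (fun h w => A.delta h w) A.μ :=
  ⟨fun I => A.hasGaussianLaw_delta_pi (fun i : I => (i : H))⟩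

theorem covariance_delta (A : AbstractWienerSpace W H) (h k : H) :
    cov[fun w => A.delta h w, fun w => A.delta k w; A.μ] = ⟪h, k⟫_ℝ := by
  rw [covariance_eq_sub (A.memLp_delta h) (A.memLp_delta k), A.integral_delta, zero_mul, sub_zero]
  exact A.integral_delta_mul_delta h k

/-- Uncorrelated families that are jointly Gaussian are independent. The index types may be
infinite, as required for the generators of `F_θ`. -/
theorem indepFun_delta_of_inner_eq_zero (A : AbstractWienerSpace W H) {S T : Type*}
    (f : S → H) (g : T → H) (hfg : ∀ s t, ⟪f s, g t⟫_ℝ = 0) :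
    IndepFun (fun w s => A.delta (f s) w) (fun w t => A.delta (g t) w) A.μ := by
  refine IsGaussianProcess.indepFun_of_covariance_eq_zero (X := fun s w => A.delta (f s) w)
    (Y := fun t w => A.delta (g t) w) ?_ (fun s => (A.measurable_delta _).aemeasurable)
    (fun t => (A.measurable_delta _).aemeasurable) fun s t => ?_
  · have h := A.isGaussianProcess_delta.comp_right (Sum.elim f g)
    rw [Sum.comp_elim] at h
    exact h
  · exact (A.covariance_delta _ _).trans (hfg s t)

end AbstractWienerSpace

/-! ### Weighted shifts: decay of powers and invariant subspaces -/

noncomputable section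

section RankOneSeries

variable {H : Type*} [NormedAddCommGroup H] [InnerProductSpace ℝ H] [CompleteSpace H]

/-- The operator `h ↦ ∑ a_i (f_i, h) g_i`. -/
def rankOneSeries (a : ℕ → ℝ) (f g : ℕ → H) : H →L[ℝ] H :=
  ∑' i, a i • (innerSL ℝ (f i)).smulRight (g i)

variable {a : ℕ → ℝ} {f g : ℕ → H}

theorem summable_rankOne (ha : Summable fun i => ‖a i‖) (hf : ∀ i, ‖f i‖ = 1)
    (hg : ∀ i, ‖g i‖ = 1) :
    Summable fun i => a i • (innerSL ℝ (f i)).smulRight (g i) := by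
  refine Summable.of_norm (ha.congr fun i => ?_)
  rw [norm_smul, ContinuousLinearMap.norm_smulRight_apply, innerSL_apply_norm, hf, hg]
  simp

theorem hasSum_rankOneSeries (ha : Summable fun i => ‖a i‖) (hf : ∀ i, ‖f i‖ = 1)
    (hg : ∀ i, ‖g i‖ = 1) (h : H) :
    HasSum (fun i => (a i * ⟪f i, h⟫_ℝ) • g i) (rankOneSeries a f g h) := by
  have h1 := (summable_rankOne ha hf hg).hasSum.mapL (ContinuousLinearMap.apply ℝ H h)
  simpa [smul_smul, rankOneSeries] using h1

theorem inner_rankOneSeries_swap (ha : Summable fun i => ‖a i‖) (hf : ∀ i, ‖f i‖ = 1)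
    (hg : ∀ i, ‖g i‖ = 1) (x y : H) :
    ⟪rankOneSeries a f g x, y⟫_ℝ = ⟪x, rankOneSeries a g f y⟫_ℝ := by
  have h1 := (hasSum_rankOneSeries ha hf hg x).mapL (innerSL ℝ y)
  have h2 := (hasSum_rankOneSeries ha hg hf y).mapL (innerSL ℝ x)
  simp only [innerSL_apply_apply, inner_smul_right] at h1 h2
  rw [real_inner_comm]
  refine h1.unique (h2.congr_fun ?_)
  intro i
  rw [real_inner_comm x (f i), real_inner_comm y (g i)]
  ring

end RankOneSeries

namespace HilbertBasis

variable {H : Type*} [NormedAddCommGroup H] [InnerProductSpace ℝ H] (e : HilbertBasis ℕ ℝ H)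

theorem norm_apply (i : ℕ) : ‖e i‖ = 1 := e.orthonormal.1 i

theorem hasSum_sq_inner (x : H) : HasSum (fun i => ⟪e i, x⟫_ℝ ^ 2) (‖x‖ ^ 2) := by
  rw [← real_inner_self_eq_norm_sq]
  refine (e.hasSum_inner_mul_inner x x).congr_fun fun i => ?_
  rw [sq, real_inner_comm]

theorem norm_sq_le_of_forall_sq_inner_le {x y : H} (n : ℕ)
    (h : ∀ i, ⟪e i, y⟫_ℝ ^ 2 ≤ ⟪e (i + n), x⟫_ℝ ^ 2) : ‖y‖ ^ 2 ≤ ‖x‖ ^ 2 := by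
  have h1 := (e.hasSum_sq_inner x).summable
  calc ‖y‖ ^ 2 = ∑' i, ⟪e i, y⟫_ℝ ^ 2 := (e.hasSum_sq_inner y).tsum_eq.symm
    _ ≤ ∑' i, ⟪e (i + n), x⟫_ℝ ^ 2 :=
      (e.hasSum_sq_inner y).summable.tsum_le_tsum h ((summable_nat_add_iff n).2 h1)
    _ ≤ ∑' i, ⟪e i, x⟫_ℝ ^ 2 := by
      rw [← h1.sum_add_tsum_nat_add n]
      exact le_add_of_nonneg_left (Finset.sum_nonneg fun i _ => sq_nonneg _)
    _ = ‖x‖ ^ 2 := (e.hasSum_sq_inner x).tsum_eq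

theorem inner_eq_of_hasSum {c : ℕ → ℝ} {x : H} (h : HasSum (fun i => c i • e i) x) (j : ℕ) :
    ⟪e j, x⟫_ℝ = c j := by
  have h1 := h.mapL (innerSL ℝ (e j))
  simp only [innerSL_apply_apply, inner_smul_right] at h1
  refine (h1.unique (hasSum_single j fun i hi => ?_)).trans ?_
  · rw [e.orthonormal.2 (Ne.symm hi), mul_zero]
  · rw [real_inner_self_eq_norm_sq, e.norm_apply]; simp

variable [CompleteSpace H]

/-- The weighted backward shift `h ↦ ∑ q ^ (i + 1) (e_{i+1}, h) e_i`. -/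
def backwardShift (q : ℝ) : H →L[ℝ] H :=
  rankOneSeries (fun i => q ^ (i + 1)) (fun i => e (i + 1)) (fun i => e i)

/-- The weighted forward shift `h ↦ ∑ q ^ (i + 1) (e_i, h) e_{i+1}`. -/
def forwardShift (q : ℝ) : H →L[ℝ] H :=
  rankOneSeries (fun i => q ^ (i + 1)) (fun i => e i) (fun i => e (i + 1))

variable {q : ℝ}

theorem summable_norm_weight (hq0 : 0 < q) (hq1 : q < 1) :
    Summable fun i : ℕ => ‖q ^ (i + 1)‖ := by
  simp_rw [norm_pow]
  exact (summable_nat_add_iff 1).2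
    (summable_geometric_of_lt_one (norm_nonneg q) (by rwa [Real.norm_of_nonneg hq0.le]))

theorem hasSum_backwardShift (hq0 : 0 < q) (hq1 : q < 1) (h : H) :
    HasSum (fun i => (q ^ (i + 1) * ⟪e (i + 1), h⟫_ℝ) • e i) (e.backwardShift q h) :=
  hasSum_rankOneSeries (summable_norm_weight hq0 hq1) (fun _ => e.norm_apply _)
    (fun _ => e.norm_apply _) h

theorem hasSum_forwardShift (hq0 : 0 < q) (hq1 : q < 1) (h : H) :
    HasSum (fun i => (q ^ (i + 1) * ⟪e i, h⟫_ℝ) • e (i + 1)) (e.forwardShift q h) :=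
  hasSum_rankOneSeries (summable_norm_weight hq0 hq1) (fun _ => e.norm_apply _)
    (fun _ => e.norm_apply _) h

theorem inner_forwardShift (hq0 : 0 < q) (hq1 : q < 1) (x y : H) :
    ⟪e.forwardShift q x, y⟫_ℝ = ⟪x, e.backwardShift q y⟫_ℝ :=
  inner_rankOneSeries_swap (summable_norm_weight hq0 hq1) (fun _ => e.norm_apply _)
    (fun _ => e.norm_apply _) x y

theorem inner_backwardShift (hq0 : 0 < q) (hq1 : q < 1) (i : ℕ) (x : H) :
    ⟪e i, e.backwardShift q x⟫_ℝ = q ^ (i + 1) * ⟪e (i + 1), x⟫_ℝ :=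
  e.inner_eq_of_hasSum (e.hasSum_backwardShift hq0 hq1 x) i

/-- The weights met on the way from `e (i + m)` down to `e i` are `q^{i+1}, …, q^{i+m}`. Their
product is split into a factor independent of `i`, which is the norm bound, and `q^{im}`, which
makes the higher coordinates negligible. -/
theorem inner_backwardShift_pow (hq0 : 0 < q) (hq1 : q < 1) (m i : ℕ) (x : H) :
    ⟪e i, (e.backwardShift q ^ m) x⟫_ℝ =
      q ^ (∑ j ∈ Finset.range m, (j + 1)) * (q ^ (i * m) * ⟪e (i + m), x⟫_ℝ) := by
  induction m generalizing i with
  | zero => simp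
  | succ m ih =>
    rw [pow_succ', mul_apply_eq_comp, e.inner_backwardShift hq0 hq1, ih,
      Finset.sum_range_succ, add_right_comm, add_assoc i m 1]
    ring

theorem norm_backwardShift_pow_le (hq0 : 0 < q) (hq1 : q < 1) (m : ℕ) :
    ‖e.backwardShift q ^ m‖ ≤ q ^ (∑ j ∈ Finset.range m, (j + 1)) := by
  set p := q ^ (∑ j ∈ Finset.range m, (j + 1)) with hp
  have hp0 : 0 < p := by positivity
  refine ContinuousLinearMap.opNorm_le_bound _ hp0.le fun x => ?_
  rw [← sq_le_sq₀ (norm_nonneg _) (by positivity), ← abs_of_pos hp0, ← Real.norm_eq_abs,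
    ← norm_smul]
  refine e.norm_sq_le_of_forall_sq_inner_le m fun i => ?_
  rw [e.inner_backwardShift_pow hq0 hq1, inner_smul_right, mul_pow, mul_pow, mul_pow]
  refine mul_le_mul_of_nonneg_left ?_ (sq_nonneg _)
  refine mul_le_of_le_one_left (sq_nonneg _) (pow_le_one₀ (by positivity) ?_)
  exact pow_le_one₀ hq0.le hq1.le

theorem tendsto_norm_backwardShift_pow (hq0 : 0 < q) (hq1 : q < 1) :
    Tendsto (fun n : ℕ => ‖e.backwardShift q ^ n‖ ^ (1 / (n : ℝ))) atTop (𝓝 0) := by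
  -- The `n`-th root of `q^{n(n+1)/2}` is `q^{(n+1)/2}`, which lies below the geometric sequence
  -- `(√q)^n`.
  have h1 : Tendsto (fun n : ℕ => (q ^ ((2 : ℝ)⁻¹)) ^ n) atTop (𝓝 0) :=
    tendsto_pow_atTop_nhds_zero_of_lt_one (by positivity)
      (Real.rpow_lt_one hq0.le hq1 (by norm_num))
  refine squeeze_zero' (Eventually.of_forall fun n => by positivity) ?_ h1
  filter_upwards [eventually_gt_atTop 0] with n hn
  have hn' : (0 : ℝ) < n := by exact_mod_cast hn
  have hsum : ((∑ j ∈ Finset.range n, (j + 1) : ℕ) : ℝ) = n * (n + 1) / 2 := by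
    clear hn hn'
    induction n with
    | zero => simp
    | succ n ih => rw [Finset.sum_range_succ]; push_cast at ih ⊢; rw [ih]; ring
  calc ‖e.backwardShift q ^ n‖ ^ (1 / (n : ℝ))
      ≤ (q ^ (∑ j ∈ Finset.range n, (j + 1))) ^ (1 / (n : ℝ)) :=
        Real.rpow_le_rpow (norm_nonneg _) (e.norm_backwardShift_pow_le hq0 hq1 n) (by positivity)
    _ = q ^ (((n : ℝ) + 1) / 2) := by
        rw [← Real.rpow_natCast, hsum, ← Real.rpow_mul hq0.le]
        congr 1
        field_simp
    _ ≤ q ^ ((2 : ℝ)⁻¹ * n) :=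
        Real.rpow_le_rpow_of_exponent_ge hq0 hq1.le (by linarith)
    _ = (q ^ ((2 : ℝ)⁻¹)) ^ n := by rw [Real.rpow_mul hq0.le, Real.rpow_natCast]

/-- A bounded operator whose kernel is invariant under the weighted backward shift either vanishes
at the first basis vector or is injective. -/
theorem eq_zero_of_forall_backwardShift_mem_ker (hq0 : 0 < q) (hq1 : q < 1) {P : H →L[ℝ] H}
    (hP : ∀ x, P x = 0 → P (e.backwardShift q x) = 0) (h0 : P (e 0) ≠ 0) {x : H} (hx : P x = 0) :
    x = 0 := by
  set c : ℝ := (‖P‖ / ‖P (e 0)‖) ^ 2 with hc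
  have hd : 0 < ‖P (e 0)‖ := norm_pos_iff.2 h0
  have hs := (e.hasSum_sq_inner x).summable
  -- The squared tail norms of `x`. The aim is `T 0 ≤ K * T m` with `K` independent of `m`, which
  -- forces `T 0 = 0`.
  let T : ℕ → ℝ := fun m => ∑' i, ⟪e (i + m), x⟫_ℝ ^ 2
  have hT : ∀ m, T m = ⟪e m, x⟫_ℝ ^ 2 + T (m + 1) := fun m => by
    have := ((summable_nat_add_iff m).2 hs).tsum_eq_zero_add
    simpa only [T, zero_add, add_assoc, add_comm 1 m] using this
  have hT0 : ∀ m, 0 ≤ T m := fun m => tsum_nonneg fun i => sq_nonneg _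
  have hpow : ∀ m, P ((e.backwardShift q ^ m) x) = 0 := fun m => by
    induction m with
    | zero => simpa using hx
    | succ m ih => rw [pow_succ', mul_apply_eq_comp]; exact hP _ ih
  have hkey : ∀ m, ⟪e m, x⟫_ℝ ^ 2 ≤ c * (q ^ 2) ^ m * T (m + 1) := fun m => by
    set p := q ^ (∑ j ∈ Finset.range m, (j + 1)) with hp
    have hp0 : p ≠ 0 := by positivity
    -- Normalised, the `m`-th image of `x` is `(e m, x) e 0` plus a remainder `z` supported on the
    -- later basis vectors and of norm at most `q^m` times that of the tail. As `P` kills the image,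
    -- `P z = -(e m, x) P (e 0)`; since `P (e 0) ≠ 0`, the coordinate is controlled by the tail
    -- beyond it.
    set z := p⁻¹ • (e.backwardShift q ^ m) x - ⟪e m, x⟫_ℝ • e 0 with hz
    have hz0 : ⟪e 0, z⟫_ℝ = 0 := by
      rw [hz, inner_sub_right, inner_smul_right, inner_smul_right, real_inner_self_eq_norm_sq,
        e.norm_apply, e.inner_backwardShift_pow hq0 hq1, ← hp, inv_mul_cancel_left₀ hp0]
      simp
    have hzs : ∀ i, ⟪e (i + 1), z⟫_ℝ = q ^ ((i + 1) * m) * ⟪e (i + (m + 1)), x⟫_ℝ := fun i => by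
      rw [hz, inner_sub_right, inner_smul_right, inner_smul_right,
        e.orthonormal.2 (Nat.succ_ne_zero i), e.inner_backwardShift_pow hq0 hq1, ← hp,
        inv_mul_cancel_left₀ hp0, mul_zero, sub_zero, add_assoc i, add_comm 1 m]
    have hzn : ‖z‖ ^ 2 ≤ (q ^ 2) ^ m * T (m + 1) := by
      rw [← (e.hasSum_sq_inner z).tsum_eq, (e.hasSum_sq_inner z).summable.tsum_eq_zero_add, hz0,
        zero_pow two_ne_zero, zero_add, ← tsum_mul_left]
      refine Summable.tsum_le_tsum (fun i => ?_)
        ((summable_nat_add_iff 1).2 (e.hasSum_sq_inner z).summable)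
        (((summable_nat_add_iff (m + 1)).2 hs).mul_left _)
      rw [hzs, mul_pow, ← pow_mul, ← pow_mul]
      refine mul_le_mul_of_nonneg_right (pow_le_pow_of_le_one hq0.le hq1.le ?_) (sq_nonneg _)
      nlinarith
    have hPz : P z = -(⟪e m, x⟫_ℝ • P (e 0)) := by
      rw [hz, map_sub, map_smul, map_smul, hpow, smul_zero, zero_sub]
    have h1 : |⟪e m, x⟫_ℝ| * ‖P (e 0)‖ ≤ ‖P‖ * ‖z‖ := by
      rw [← Real.norm_eq_abs, ← norm_smul, ← norm_neg, ← hPz]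
      exact P.le_opNorm z
    have h2 : |⟪e m, x⟫_ℝ| ≤ ‖P‖ / ‖P (e 0)‖ * ‖z‖ := by
      rw [div_mul_eq_mul_div, le_div_iff₀ hd]
      exact h1
    calc ⟪e m, x⟫_ℝ ^ 2 = |⟪e m, x⟫_ℝ| ^ 2 := (sq_abs _).symm
      _ ≤ (‖P‖ / ‖P (e 0)‖ * ‖z‖) ^ 2 := pow_le_pow_left₀ (abs_nonneg _) h2 2
      _ = c * ‖z‖ ^ 2 := by rw [mul_pow]
      _ ≤ c * ((q ^ 2) ^ m * T (m + 1)) := mul_le_mul_of_nonneg_left hzn (sq_nonneg _)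
      _ = _ := by ring
  -- The factor `1 + c q^{2m}` is replaced by an exponential, so that the infinite product is
  -- bounded by means of a geometric series.
  have hstep : ∀ m, T m ≤ Real.exp (c * (q ^ 2) ^ m) * T (m + 1) := fun m => by
    rw [hT m]
    nlinarith [hkey m, mul_le_mul_of_nonneg_right (Real.add_one_le_exp (c * (q ^ 2) ^ m))
      (hT0 (m + 1))]
  have hprod : ∀ m, T 0 ≤ Real.exp (c * ∑ k ∈ Finset.range m, (q ^ 2) ^ k) * T m := fun m => by
    induction m with
    | zero => simp
    | succ m ih =>
      refine ih.trans ?_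
      rw [Finset.sum_range_succ, mul_add, Real.exp_add, mul_assoc]
      exact mul_le_mul_of_nonneg_left (hstep m) (Real.exp_pos _).le
  have hq2 : q ^ 2 < 1 := pow_lt_one₀ hq0.le hq1 two_ne_zero
  have hbound : ∀ m, T 0 ≤ Real.exp (c * ∑' k : ℕ, (q ^ 2) ^ k) * T m := fun m => by
    refine (hprod m).trans (mul_le_mul_of_nonneg_right (Real.exp_le_exp.2
      (mul_le_mul_of_nonneg_left ?_ (sq_nonneg _))) (hT0 m))
    exact (summable_geometric_of_lt_one (sq_nonneg q) hq2).sum_le_tsum _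
      fun i _ => by positivity
  have hlim : Tendsto T atTop (𝓝 0) := tendsto_sum_nat_add fun i => ⟪e i, x⟫_ℝ ^ 2
  have hle : T 0 ≤ 0 := by
    have := ge_of_tendsto' (hlim.const_mul (Real.exp (c * ∑' k : ℕ, (q ^ 2) ^ k))) hbound
    rwa [mul_zero] at this
  have hxx : ‖x‖ ^ 2 = T 0 := (e.hasSum_sq_inner x).tsum_eq.symm
  have hx2 : ‖x‖ ^ 2 = 0 := le_antisymm (hxx ▸ hle) (sq_nonneg _)
  exact norm_eq_zero.1 ((sq_eq_zero_iff).1 hx2)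

/-- No continuous resolution of the identity has all its kernels invariant under the weighted
backward shift. -/
theorem not_forall_backwardShift_mem_ker (hq0 : 0 < q) (hq1 : q < 1)
    (π : ContinuousResolution H) :
    ¬ ∀ θ x, π.proj θ x = 0 → π.proj θ (e.backwardShift q x) = 0 := by
  intro h
  -- By the intermediate value theorem; any value strictly between 0 and 1 would serve.
  obtain ⟨θ, hθ⟩ : ∃ θ, ‖π.proj θ (e 0)‖ = 1 / 2 := by
    refine mem_range_of_exists_le_of_exists_ge (π.continuous_apply (e 0)).norm ⟨0, ?_⟩ ⟨1, ?_⟩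
    · rw [π.proj_zero]; simp
    · rw [π.proj_one]; simp only [one_apply_eq_self, e.norm_apply]; norm_num
  have h0 : π.proj θ (e 0) ≠ 0 := fun h0 => by rw [h0] at hθ; norm_num at hθ
  have hidem : π.proj θ (π.proj θ (e 0)) = π.proj θ (e 0) :=
    DFunLike.congr_fun (π.isStarProjection θ).isIdempotentElem (e 0)
  -- This vector lies in the kernel because the projection is idempotent, and the kernel is trivial.
  have h1 : π.proj θ (e 0) - e 0 = 0 :=
    e.eq_zero_of_forall_backwardShift_mem_ker hq0 hq1 (h θ) h0
      (by rw [map_sub, hidem, sub_self])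
  rw [sub_eq_zero.1 h1, e.norm_apply] at hθ
  norm_num at hθ

end HilbertBasis

end

/-! ### Hilbert–Schmidt bounds and the gradient of the shift field -/

noncomputable section

/-- Parseval for each `T x` and an exchange of sums leave `∑ b i * ∑_{x ∈ s} (e (i + 1), x)^2`.
Bessel's inequality for the orthonormal set `s` bounds the inner sum by 1. -/
theorem hsNormSq_le_of_forall_sq_inner_le {H : Type*} [NormedAddCommGroup H]
    [InnerProductSpace ℝ H] [CompleteSpace H] (e : HilbertBasis ℕ ℝ H) {T : H →L[ℝ] H}
    {b : ℕ → ℝ} (hb : Summable b) (hb0 : ∀ i, 0 ≤ b i)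
    (h : ∀ i x, ⟪e i, T x⟫_ℝ ^ 2 ≤ b i * ⟪e (i + 1), x⟫_ℝ ^ 2) :
    hsNormSq T ≤ ENNReal.ofReal (∑' i, b i) := by
  refine iSup₂_le fun s hs => ?_
  have hbd : ∀ i, b i * ∑ x ∈ s, ⟪e (i + 1), x⟫_ℝ ^ 2 ≤ b i := fun i => by
    refine mul_le_of_le_one_right (hb0 i) ?_
    have h1 := hs.sum_inner_products_le (s := Finset.univ) (e (i + 1))
    rw [e.norm_apply, one_pow, Finset.univ_eq_attach,
      Finset.sum_attach s (fun x => ‖⟪x, e (i + 1)⟫_ℝ‖ ^ 2)] at h1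
    refine (Finset.sum_le_sum fun x _ => ?_).trans h1
    rw [Real.norm_eq_abs, sq_abs, real_inner_comm]
  have hsum : Summable fun i => b i * ∑ x ∈ s, ⟪e (i + 1), x⟫_ℝ ^ 2 :=
    Summable.of_nonneg_of_le (fun i => mul_nonneg (hb0 i)
      (Finset.sum_nonneg fun _ _ => sq_nonneg _)) hbd hb
  have hT : ∑ x ∈ s, ‖T x‖ ^ 2 ≤ ∑' i, b i := by
    calc ∑ x ∈ s, ‖T x‖ ^ 2 = ∑ x ∈ s, ∑' i, ⟪e i, T x⟫_ℝ ^ 2 :=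
          Finset.sum_congr rfl fun x _ => (e.hasSum_sq_inner (T x)).tsum_eq.symm
      _ = ∑' i, ∑ x ∈ s, ⟪e i, T x⟫_ℝ ^ 2 :=
          (Summable.tsum_finsetSum fun x _ => (e.hasSum_sq_inner (T x)).summable).symm
      _ ≤ ∑' i, b i * ∑ x ∈ s, ⟪e (i + 1), x⟫_ℝ ^ 2 := by
          refine Summable.tsum_le_tsum (fun i => ?_)
            (summable_sum fun x _ => (e.hasSum_sq_inner (T x)).summable) hsum
          rw [Finset.mul_sum]
          exact Finset.sum_le_sum fun x _ => h i x
      _ ≤ ∑' i, b i := hsum.tsum_le_tsum hbd hb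
  calc ∑ x ∈ s, ‖T x‖ₑ ^ 2 = ENNReal.ofReal (∑ x ∈ s, ‖T x‖ ^ 2) := by
        rw [ENNReal.ofReal_sum_of_nonneg fun _ _ => sq_nonneg _]
        refine Finset.sum_congr rfl fun x _ => ?_
        rw [← ofReal_norm, ENNReal.ofReal_pow (norm_nonneg _)]
    _ ≤ _ := ENNReal.ofReal_le_ofReal hT

theorem hsNormSq_backwardShift_lt_top {H : Type*} [NormedAddCommGroup H]
    [InnerProductSpace ℝ H] [CompleteSpace H] (e : HilbertBasis ℕ ℝ H) {q : ℝ} (hq0 : 0 < q)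
    (hq1 : q < 1) : hsNormSq (e.backwardShift q) < ∞ := by
  have hs : Summable fun i : ℕ => (q ^ (i + 1)) ^ 2 := by
    simp_rw [← pow_mul, mul_comm _ 2, pow_mul]
    exact (summable_nat_add_iff 1).2 (summable_geometric_of_lt_one (sq_nonneg q)
      (pow_lt_one₀ hq0.le hq1 two_ne_zero))
  refine (hsNormSq_le_of_forall_sq_inner_le e hs (fun _ => sq_nonneg _) fun i x => ?_).trans_lt
    ENNReal.ofReal_lt_top
  rw [e.inner_backwardShift hq0 hq1, mul_pow]

theorem isQuasinilpotent_backwardShift {H : Type*} [NormedAddCommGroup H]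
    [InnerProductSpace ℝ H] [CompleteSpace H] (e : HilbertBasis ℕ ℝ H) {q : ℝ} (hq0 : 0 < q)
    (hq1 : q < 1) : IsQuasinilpotent (e.backwardShift q) :=
  ⟨hsNormSq_backwardShift_lt_top e hq0 hq1, e.tendsto_norm_backwardShift_pow hq0 hq1⟩

/-- A subsequence of an `L^p`-convergent sequence converges a.e., so the two limits agree. -/
theorem ae_eq_of_tendsto_Lp_of_ae_tendsto {Ω E : Type*} [MeasurableSpace Ω] {μ : Measure Ω}
    [NormedAddCommGroup E] {f : ℕ → Lp E 2 μ} {F : Lp E 2 μ} {g : Ω → E}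
    (hF : Tendsto f atTop (𝓝 F)) (hg : ∀ᵐ w ∂μ, Tendsto (fun n => f n w) atTop (𝓝 (g w))) :
    F =ᵐ[μ] g := by
  obtain ⟨ns, hns, h⟩ := (tendstoInMeasure_of_tendsto_Lp hF).exists_seq_tendsto_ae
  filter_upwards [h, hg] with w h1 h2
  exact tendsto_nhds_unique h1 (h2.comp hns.tendsto_atTop)

theorem two_rpow_weight (α : ℝ) (i : ℕ) :
    (2 : ℝ) ^ (-((i : ℝ) + 1) * α) = ((2 : ℝ) ^ (-α)) ^ (i + 1) := by
  rw [← Real.rpow_natCast, ← Real.rpow_mul (by norm_num)]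
  push_cast
  ring_nf

namespace AbstractWienerSpace

variable {W H : Type*} [NormedAddCommGroup W] [NormedSpace ℝ W] [MeasurableSpace W] [BorelSpace W]
  [NormedAddCommGroup H] [InnerProductSpace ℝ H] [CompleteSpace H]

theorem cylinderGrad_apply {X : Type*} [NormedAddCommGroup X] [InnerProductSpace ℝ X]
    (A : AbstractWienerSpace W H) (F : SmoothCylinder H X) (w : W) (k : H) :
    A.cylinderGrad F w k = ∑ j, fderiv ℝ (F.coeff j) (fun l => A.delta (F.dir l) w)
      (fun i => ⟪F.dir i, k⟫_ℝ) • F.vec j := by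
  simp only [cylinderGrad, sum_apply, ContinuousLinearMap.smulRight_apply]
  refine Finset.sum_congr rfl fun j _ => ?_
  congr 1
  conv_rhs => rw [← Finset.univ_sum_single (fun i => ⟪F.dir i, k⟫_ℝ), map_sum]
  refine Finset.sum_congr rfl fun i _ => ?_
  rw [smul_apply, innerSL_apply_apply, smul_eq_mul, mul_comm,
    ← smul_eq_mul, ← map_smul, ← Pi.single_smul, smul_eq_mul, mul_one]

section Shift

variable (A : AbstractWienerSpace W H) (e : HilbertBasis ℕ ℝ H) {q : ℝ}

/-- Each `δ(e (i + 1))` has `L²` norm 1, hence `L¹` norm at most 1, so the sum of the expectations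
is dominated by a geometric series. -/
theorem ae_summable_norm_weight_mul_delta (hq0 : 0 < q) (hq1 : q < 1) :
    ∀ᵐ w ∂A.μ, Summable fun i : ℕ => ‖q ^ (i + 1) * A.delta (e (i + 1)) w‖ := by
  have hm : ∀ i : ℕ, Measurable fun w => q ^ (i + 1) * A.delta (e (i + 1)) w := fun i =>
    (A.measurable_delta _).const_mul _
  have h1 : ∫⁻ w, ∑' i : ℕ, ‖q ^ (i + 1) * A.delta (e (i + 1)) w‖ₑ ∂A.μ ≠ ∞ := by
    rw [lintegral_tsum fun i => (hm i).enorm.aemeasurable]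
    have h2 : ∀ i : ℕ, ∫⁻ w, ‖q ^ (i + 1) * A.delta (e (i + 1)) w‖ₑ ∂A.μ ≤ ‖q ^ (i + 1)‖₊ := by
      intro i
      simp_rw [enorm_mul]
      rw [lintegral_const_mul _ (A.measurable_delta _).enorm, ← enorm_eq_nnnorm]
      refine mul_le_of_le_one_right zero_le ?_
      rw [← eLpNorm_one_eq_lintegral_enorm]
      refine (eLpNorm_le_eLpNorm_of_exponent_le (q := 2) (by norm_num)
        (A.memLp_delta _).1).trans ?_
      rw [← Lp.enorm_def, ← ofReal_norm, A.norm_delta, e.norm_apply, ENNReal.ofReal_one]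
    refine ne_top_of_le_ne_top ?_ (ENNReal.tsum_le_tsum h2)
    rw [ENNReal.tsum_coe_ne_top_iff_summable, ← NNReal.summable_coe]
    exact HilbertBasis.summable_norm_weight hq0 hq1
  filter_upwards [ae_lt_top' (AEMeasurable.tsum fun i => (hm i).enorm.aemeasurable) h1]
    with w hw
  simp_rw [enorm_eq_nnnorm] at hw
  exact NNReal.summable_coe.2 (ENNReal.tsum_coe_ne_top_iff_summable.1 hw.ne)

/-- The partial sums of the series defining the shift field. -/
def shiftCylinder (q : ℝ) (n : ℕ) : SmoothCylinder H H where
  n := n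
  m := n
  dir i := e (i + 1)
  coeff j x := q ^ ((j : ℕ) + 1) * x j
  temperate j := (q ^ ((j : ℕ) + 1) • (ContinuousLinearMap.proj j :
    (Fin n → ℝ) →L[ℝ] ℝ)).hasTemperateGrowth
  vec j := e j

theorem cylinderEval_shiftCylinder (q : ℝ) (n : ℕ) (w : W) :
    A.cylinderEval (shiftCylinder e q n) w =
      ∑ i ∈ Finset.range n, (q ^ (i + 1) * A.delta (e (i + 1)) w) • e i :=
  Fin.sum_univ_eq_sum_range (fun i => (q ^ (i + 1) * A.delta (e (i + 1)) w) • e i) n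

theorem cylinderGrad_shiftCylinder (q : ℝ) (n : ℕ) (w : W) (x : H) :
    A.cylinderGrad (shiftCylinder e q n) w x =
      ∑ i ∈ Finset.range n, (q ^ (i + 1) * ⟪e (i + 1), x⟫_ℝ) • e i := by
  rw [← Fin.sum_univ_eq_sum_range (fun i => (q ^ (i + 1) * ⟪e (i + 1), x⟫_ℝ) • e i) n,
    cylinderGrad_apply]
  refine Finset.sum_congr rfl fun (j : Fin n) _ => ?_
  have hd : ∀ y : Fin n → ℝ, fderiv ℝ ((shiftCylinder e q n).coeff j) y =
      q ^ ((j : ℕ) + 1) • (ContinuousLinearMap.proj j : (Fin n → ℝ) →L[ℝ] ℝ) := fun y =>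
    (q ^ ((j : ℕ) + 1) • (ContinuousLinearMap.proj j : (Fin n → ℝ) →L[ℝ] ℝ)).fderiv
  exact congrArg (· • e j) (DFunLike.congr_fun (hd _) _)

theorem inner_cylinderGrad_sub_backwardShift (hq0 : 0 < q) (hq1 : q < 1) (n : ℕ) (w : W) (i : ℕ)
    (x : H) : ⟪e i, (A.cylinderGrad (shiftCylinder e q n) w - e.backwardShift q) x⟫_ℝ =
      if i < n then 0 else -(q ^ (i + 1) * ⟪e (i + 1), x⟫_ℝ) := by
  rw [sub_apply, inner_sub_right, e.inner_backwardShift hq0 hq1,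
    cylinderGrad_shiftCylinder, inner_sum]
  simp_rw [inner_smul_right, orthonormal_iff_ite.1 e.orthonormal]
  by_cases h : i < n <;> simp [h]

theorem hsNormSq_cylinderGrad_sub_backwardShift_le (hq0 : 0 < q) (hq1 : q < 1) (n : ℕ) (w : W) :
    hsNormSq (A.cylinderGrad (shiftCylinder e q n) w - e.backwardShift q) ≤
      ENNReal.ofReal (q ^ n * ∑' i : ℕ, q ^ (i + 1)) := by
  rw [← tsum_mul_left]
  have hs : Summable fun i : ℕ => q ^ (i + 1) :=
    (summable_nat_add_iff 1).2 (summable_geometric_of_lt_one hq0.le hq1)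
  refine hsNormSq_le_of_forall_sq_inner_le e (hs.mul_left _) (fun i => by positivity)
    fun i x => ?_
  rw [A.inner_cylinderGrad_sub_backwardShift e hq0 hq1]
  split_ifs with h
  · rw [zero_pow two_ne_zero]
    positivity
  -- Only indices `i ≥ n` survive, and there `2(i + 1) ≥ n + (i + 1)`: half of the squared weight
  -- pays for the factor `q^n`, the other half for summability.
  · rw [neg_sq, mul_pow, ← pow_mul, ← pow_add]
    refine mul_le_mul_of_nonneg_right (pow_le_pow_of_le_one hq0.le hq1.le ?_) (sq_nonneg _)
    omega

/-- A term of the series defining the shift field, in `L²(μ; H)`. -/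
def shiftTerm (q : ℝ) (i : ℕ) : Lp H 2 A.μ :=
  (ContinuousLinearMap.toSpanSingleton ℝ (e i)).compLp (A.delta (q ^ (i + 1) • e (i + 1)))

theorem coeFn_shiftTerm (q : ℝ) (i : ℕ) :
    A.shiftTerm e q i =ᵐ[A.μ] fun w => (q ^ (i + 1) * A.delta (e (i + 1)) w) • e i := by
  filter_upwards [(ContinuousLinearMap.toSpanSingleton ℝ (e i)).coeFn_compLp
    (A.delta (q ^ (i + 1) • e (i + 1))), A.delta_smul (q ^ (i + 1)) (e (i + 1))] with w h1 h2
  rw [shiftTerm, h1, h2, ContinuousLinearMap.toSpanSingleton_apply]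

theorem summable_shiftTerm (hq0 : 0 < q) (hq1 : q < 1) : Summable (A.shiftTerm e q) := by
  refine Summable.of_norm_bounded (HilbertBasis.summable_norm_weight hq0 hq1) fun i => ?_
  refine (ContinuousLinearMap.norm_compLp_le _ _).trans ?_
  rw [ContinuousLinearMap.norm_toSpanSingleton, e.norm_apply, one_mul, A.norm_delta, norm_smul,
    e.norm_apply, mul_one]

theorem coeFn_sum_shiftTerm (q : ℝ) (n : ℕ) :
    (∑ i ∈ Finset.range n, A.shiftTerm e q i : Lp H 2 A.μ) =ᵐ[A.μ]
      A.cylinderEval (shiftCylinder e q n) := by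
  filter_upwards [Lp.coeFn_finsetSum (Finset.range n) (A.shiftTerm e q),
    ae_all_iff.2 (A.coeFn_shiftTerm e q)] with w h1 h2
  rw [h1, A.cylinderEval_shiftCylinder, Finset.sum_apply]
  exact Finset.sum_congr rfl fun i _ => h2 i

variable {α : ℝ}

theorem shiftField_eq (α : ℝ) (w : W) : A.shiftField e α w =
    ∑' i : ℕ, (((2 : ℝ) ^ (-α)) ^ (i + 1) * A.delta (e (i + 1)) w) • e i := by
  simp_rw [shiftField, two_rpow_weight]

theorem two_rpow_neg_lt_one (hα : 0 < α) : (2 : ℝ) ^ (-α) < 1 :=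
  Real.rpow_lt_one_of_one_lt_of_neg (by norm_num) (by linarith)

theorem ae_hasSum_shiftField (hα : 0 < α) : ∀ᵐ w ∂A.μ,
    HasSum (fun i : ℕ => (((2 : ℝ) ^ (-α)) ^ (i + 1) * A.delta (e (i + 1)) w) • e i)
      (A.shiftField e α w) := by
  filter_upwards [A.ae_summable_norm_weight_mul_delta e (q := (2 : ℝ) ^ (-α)) (by positivity)
    (two_rpow_neg_lt_one hα)] with w hw
  rw [A.shiftField_eq]
  refine (Summable.of_norm (hw.congr fun i => ?_)).hasSum
  rw [norm_smul, e.norm_apply, mul_one]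

theorem tsum_shiftTerm_ae_eq (hα : 0 < α) :
    (∑' i, A.shiftTerm e ((2 : ℝ) ^ (-α)) i : Lp H 2 A.μ) =ᵐ[A.μ] A.shiftField e α := by
  refine ae_eq_of_tendsto_Lp_of_ae_tendsto (A.summable_shiftTerm e (by positivity)
    (two_rpow_neg_lt_one hα)).hasSum.tendsto_sum_nat ?_
  filter_upwards [A.ae_hasSum_shiftField e hα,
    ae_all_iff.2 (A.coeFn_sum_shiftTerm e ((2 : ℝ) ^ (-α)))] with w h1 h2
  simp_rw [h2, cylinderEval_shiftCylinder]
  exact h1.tendsto_sum_nat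

theorem isGradient_shiftField (hα : 0 < α) :
    A.IsGradient (A.shiftField e α) fun _ => e.backwardShift ((2 : ℝ) ^ (-α)) := by
  set q := (2 : ℝ) ^ (-α) with hq
  have hq0 : 0 < q := by positivity
  have hq1 : q < 1 := two_rpow_neg_lt_one hα
  have hU := A.tsum_shiftTerm_ae_eq e hα
  refine ⟨(memLp_congr_ae hU).1 (Lp.memLp _), fun h => aestronglyMeasurable_const, ?_,
    shiftCylinder e q, ?_, ?_⟩
  · rw [lintegral_const, measure_univ, mul_one]
    exact hsNormSq_backwardShift_lt_top e hq0 hq1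
  · have h1 := (A.summable_shiftTerm e hq0 hq1).hasSum.tendsto_sum_nat
    rw [Lp.tendsto_Lp_iff_tendsto_eLpNorm'] at h1
    refine h1.congr fun n => eLpNorm_congr_ae ?_
    filter_upwards [A.coeFn_sum_shiftTerm e q n, hU] with w h2 h3
    rw [Pi.sub_apply, h2, h3]
  · have hlim : Tendsto (fun n : ℕ => ENNReal.ofReal (q ^ n * ∑' i : ℕ, q ^ (i + 1))) atTop
        (𝓝 0) := by
      have := (tendsto_pow_atTop_nhds_zero_of_lt_one hq0.le hq1).mul_const (∑' i : ℕ, q ^ (i + 1))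
      rw [zero_mul] at this
      simpa using ENNReal.tendsto_ofReal this
    refine tendsto_of_tendsto_of_tendsto_of_le_of_le tendsto_const_nhds hlim (fun _ => zero_le)
      fun n => ?_
    refine (lintegral_mono fun w =>
      A.hsNormSq_cylinderGrad_sub_backwardShift_le e hq0 hq1 n w).trans ?_
    rw [lintegral_const, measure_univ, mul_one]

/-- The pairing of `u` with `x` is again a first-order Gaussian variable, `δ` of the adjoint shift
applied to `x`. Its partial sums converge both a.s. and, by continuity of `δ`, in `L²`. -/
theorem inner_shiftField_ae_eq (hα : 0 < α) (x : H) :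
    (fun w => ⟪A.shiftField e α w, x⟫_ℝ) =ᵐ[A.μ]
      A.delta (e.forwardShift ((2 : ℝ) ^ (-α)) x) := by
  set q := (2 : ℝ) ^ (-α) with hq
  have h1 := (e.hasSum_forwardShift (q := q) (by positivity)
    (two_rpow_neg_lt_one hα) x).tendsto_sum_nat
  refine (ae_eq_of_tendsto_Lp_of_ae_tendsto ((A.delta.continuous.tendsto _).comp h1) ?_).symm
  filter_upwards [A.ae_hasSum_shiftField e hα, ae_all_iff.2 fun n => A.delta_sum (Finset.range n)
    (fun i => q ^ (i + 1) * ⟪e i, x⟫_ℝ) (fun i => e (i + 1))] with w h2 h3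
  have h4 := (h2.mapL (innerSL ℝ x)).tendsto_sum_nat
  simp only [innerSL_apply_apply, inner_smul_right] at h4
  rw [real_inner_comm]
  refine h4.congr fun n => ?_
  rw [Function.comp_apply, h3]
  refine Finset.sum_congr rfl fun i _ => ?_
  rw [real_inner_comm]
  ring

end Shift

/-! ### Adaptedness forces invariant subspaces -/

section Adapted

variable (A : AbstractWienerSpace W H) (π : ContinuousResolution H)

/-- With `F_θ` generated by a single function-valued variable, independence of Gaussian families
applies to it directly. -/
theorem filtration_eq_comap (θ : Set.Icc (0 : ℝ) 1) :
    A.filtration π θ = MeasurableSpace.comap (fun w h => A.delta (π.proj θ h) w)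
      MeasurableSpace.pi := by
  rw [MeasurableSpace.pi, MeasurableSpace.comap_iSup]
  simp_rw [MeasurableSpace.comap_comp]
  rfl

/-- If `δ(v)` is measurable with respect to `F_θ`, then `v` lies in the range of `π_θ`. -/
theorem proj_eq_self_of_aestronglyMeasurable {θ : Set.Icc (0 : ℝ) 1} {v : H}
    (hv : AEStronglyMeasurable[A.filtration π θ] (A.delta v) A.μ) : π.proj θ v = v := by
  set P := π.proj θ with hP
  have hidem : ∀ x, P (P x) = P x := fun x =>
    DFunLike.congr_fun (π.isStarProjection θ).isIdempotentElem x
  have hself : ∀ x y, ⟪P x, y⟫_ℝ = ⟪x, P y⟫_ℝ :=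
    (π.isStarProjection θ).isSelfAdjoint.isSymmetric
  -- The component of `v` orthogonal to the range. `δ(y)` is both `F_θ`-measurable up to a null set
  -- and independent of `F_θ`, so `‖y‖² = E[δ(y)²] = E[g] E[δ(y)] = 0`, where `g` is its
  -- `F_θ`-measurable version.
  set y := v - P v with hy
  have hPy : P y = 0 := by rw [hy, map_sub, hidem, sub_self]
  have hmeas : Measurable[A.filtration π θ] (A.delta (P v)) := by
    refine Measurable.mono (comap_measurable _) ?_ le_rfl
    exact le_iSup (fun h => MeasurableSpace.comap (A.delta (π.proj θ h)) (borel ℝ)) v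
  have hyv : A.delta y =ᵐ[A.μ] fun w => A.delta v w - A.delta (P v) w := by
    rw [hy, map_sub]
    exact Lp.coeFn_sub _ _
  have hysm : AEStronglyMeasurable[A.filtration π θ] (A.delta y) A.μ :=
    (hv.sub hmeas.stronglyMeasurable.aestronglyMeasurable).congr hyv.symm
  obtain ⟨g, hg, hyg⟩ := hysm
  have hind : IndepFun (fun w h => A.delta (P h) w) (fun w (_ : Unit) => A.delta y w) A.μ :=
    A.indepFun_delta_of_inner_eq_zero (fun h => P h) (fun _ => y) fun s _ => by
      rw [hself, hPy, inner_zero_right]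
  have hind2 : IndepFun g (A.delta y) A.μ := by
    have h1 : IndepFun (fun w h => A.delta (P h) w) (A.delta y) A.μ :=
      hind.comp measurable_id (measurable_pi_apply ())
    rw [IndepFun_iff_Indep] at h1 ⊢
    refine indep_of_indep_of_le_left h1 ?_
    rw [← A.filtration_eq_comap π θ]
    exact hg.measurable.comap_le
  have hgm : AEStronglyMeasurable g A.μ := (A.memLp_delta y).1.congr hyg
  have h0 := hind2.integral_fun_mul_eq_mul_integral hgm (A.memLp_delta y).1
  rw [A.integral_delta, mul_zero] at h0
  have h2 : ∫ w, A.delta y w * A.delta y w ∂A.μ = 0 := by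
    rw [← h0]
    refine integral_congr_ae ?_
    filter_upwards [hyg] with w hw
    rw [← hw]
  rw [A.integral_delta_mul_delta, inner_self_eq_zero, hy, sub_eq_zero] at h2
  exact h2.symm

theorem not_isAdapted_shiftField (e : HilbertBasis ℕ ℝ H) {α : ℝ} (hα : 0 < α) :
    ¬ A.IsAdapted π (A.shiftField e α) := by
  intro had
  have hq0 : 0 < (2 : ℝ) ^ (-α) := by positivity
  have hq1 := two_rpow_neg_lt_one hα
  refine e.not_forall_backwardShift_mem_ker hq0 hq1 π fun θ x hx => ?_
  have hself : ∀ x y, ⟪π.proj θ x, y⟫_ℝ = ⟪x, π.proj θ y⟫_ℝ :=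
    (π.isStarProjection θ).isSelfAdjoint.isSymmetric
  refine ext_inner_left ℝ fun h => ?_
  -- The forward shift maps the range of the projection into itself; taking adjoints turns this into
  -- invariance of the kernel under the backward shift.
  have h1 := A.proj_eq_self_of_aestronglyMeasurable π
    ((had θ h).congr (A.inner_shiftField_ae_eq e hα (π.proj θ h)))
  rw [inner_zero_right, ← hself, ← e.inner_forwardShift hq0 hq1, ← h1, hself, hx,
    inner_zero_right]

end Adapted

end AbstractWienerSpace

end

/-! ### Gaussian integration by parts -/

noncomputable section

theorem hasDerivAt_gaussianPDFReal_zero_one (x : ℝ) :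
    HasDerivAt (gaussianPDFReal 0 1) (-x * gaussianPDFReal 0 1 x) x := by
  have h1 : HasDerivAt (fun y : ℝ => -(y - 0) ^ 2 / (2 * ((1 : ℝ≥0) : ℝ))) (-x) x := by
    refine ((((hasDerivAt_id x).sub_const 0).pow 2).neg.div_const
      (2 * ((1 : ℝ≥0) : ℝ))).congr_deriv ?_
    simp
    ring
  have h2 := (h1.exp).const_mul (√(2 * Real.pi * ((1 : ℝ≥0) : ℝ)))⁻¹
  refine h2.congr_deriv ?_
  simp only [gaussianPDFReal]
  ring

theorem integrable_gaussianReal_zero_one_iff {f : ℝ → ℝ} :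
    Integrable f (gaussianReal 0 1) ↔ Integrable fun x => gaussianPDFReal 0 1 x * f x := by
  rw [gaussianReal_of_var_ne_zero 0 one_ne_zero, integrable_withDensity_iff_integrable_smul'
    (measurable_gaussianPDF 0 1) (ae_of_all _ fun _ => gaussianPDF_lt_top)]
  simp [toReal_gaussianPDF]

/-- Stein's identity: the standard Gaussian density `ρ` satisfies `ρ' = -xρ`. -/
theorem integral_deriv_gaussianReal {φ φ' : ℝ → ℝ} (h : ∀ x, HasDerivAt φ (φ' x) x)
    (h0 : Integrable φ (gaussianReal 0 1)) (h1 : Integrable φ' (gaussianReal 0 1))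
    (h2 : Integrable (fun x => x * φ x) (gaussianReal 0 1)) :
    ∫ x, φ' x ∂gaussianReal 0 1 = ∫ x, x * φ x ∂gaussianReal 0 1 := by
  rw [integral_gaussianReal_eq_integral_smul one_ne_zero,
    integral_gaussianReal_eq_integral_smul one_ne_zero]
  rw [integrable_gaussianReal_zero_one_iff] at h0 h1 h2
  have h3 := integral_mul_deriv_eq_deriv_mul_of_integrable
    (u := gaussianPDFReal 0 1) (u' := fun x => -x * gaussianPDFReal 0 1 x)
    (fun x _ => hasDerivAt_gaussianPDFReal_zero_one x) (fun x _ => h x) h1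
    (h2.neg.congr (ae_of_all _ fun x => by simp only [Pi.neg_apply, Pi.mul_apply]; ring)) h0
  simp only [smul_eq_mul]
  rw [h3, ← integral_neg]
  congr 1
  ext x
  ring

/-- Gaussian integration by parts in the direction of a standard normal variable, in the presence
of an independent parameter. -/
theorem integral_fderiv_gaussianReal_prod {ι : Type*} [Fintype ι] {f : (ι → ℝ) → ℝ}
    (hf : Differentiable ℝ f) (c : ι → ℝ) {ν : Measure (ι → ℝ)} [IsProbabilityMeasure ν]
    (h0 : Integrable (fun z : ℝ × (ι → ℝ) => f (z.1 • c + z.2)) ((gaussianReal 0 1).prod ν))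
    (h1 : Integrable (fun z : ℝ × (ι → ℝ) => fderiv ℝ f (z.1 • c + z.2) c)
      ((gaussianReal 0 1).prod ν))
    (h2 : Integrable (fun z : ℝ × (ι → ℝ) => z.1 * f (z.1 • c + z.2))
      ((gaussianReal 0 1).prod ν)) :
    ∫ z : ℝ × (ι → ℝ), fderiv ℝ f (z.1 • c + z.2) c ∂(gaussianReal 0 1).prod ν =
      ∫ z : ℝ × (ι → ℝ), z.1 * f (z.1 • c + z.2) ∂(gaussianReal 0 1).prod ν := by
  rw [integral_prod_symm _ h1, integral_prod_symm _ h2]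
  refine integral_congr_ae ?_
  filter_upwards [h0.prod_left_ae, h1.prod_left_ae, h2.prod_left_ae] with y hy0 hy1 hy2
  refine integral_deriv_gaussianReal (fun x => ?_) hy0 hy1 hy2
  have hline : HasDerivAt (fun t : ℝ => t • c + y) c x := by
    simpa using ((hasDerivAt_id x).smul_const c).add_const y
  exact (hf _).hasFDerivAt.comp_hasDerivAt x hline

theorem memLp_two_comp_of_norm_le_pow {Ω E F : Type*} [MeasurableSpace Ω] {μ : Measure Ω}
    [IsFiniteMeasure μ] [NormedAddCommGroup E] [NormedAddCommGroup F] {X : Ω → E}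
    (hX : ∀ p : ℝ≥0∞, p ≠ ∞ → MemLp X p μ) {f : E → F} (hf : Continuous f) {C : ℝ} {k : ℕ}
    (hC : ∀ x, ‖f x‖ ≤ C * (1 + ‖x‖) ^ k) : MemLp (fun w => f (X w)) 2 μ := by
  have hm : AEStronglyMeasurable (fun w => f (X w)) μ :=
    hf.comp_aestronglyMeasurable (hX 1 ENNReal.one_ne_top).1
  rw [memLp_two_iff_integrable_sq_norm hm]
  have hn : MemLp (fun w => ‖X w‖) ((2 * k : ℕ) : ℝ≥0∞) μ :=
    (hX _ (ENNReal.natCast_ne_top (2 * k))).norm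
  have h1 : MemLp (fun w => 1 + ‖X w‖) ((2 * k : ℕ) : ℝ≥0∞) μ :=
    (memLp_const (1 : ℝ)).add hn
  have h2 : Integrable (fun w => C ^ 2 * ‖1 + ‖X w‖‖ ^ (2 * k)) μ :=
    h1.integrable_norm_pow'.const_mul (C ^ 2)
  refine h2.mono' (hm.norm.pow 2) (ae_of_all _ fun w => ?_)
  have h3 : (0 : ℝ) ≤ 1 + ‖X w‖ := by positivity
  rw [Real.norm_of_nonneg (sq_nonneg _), Real.norm_of_nonneg h3, mul_comm 2 k,
    pow_mul, ← mul_pow]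
  exact pow_le_pow_left₀ (norm_nonneg _) (hC _) 2

theorem tendsto_integral_mul_of_tendsto_eLpNorm {Ω : Type*} [MeasurableSpace Ω] {μ : Measure Ω}
    {a : ℕ → Ω → ℝ} {a' b : Ω → ℝ} (ha : ∀ n, MemLp (a n) 2 μ) (ha' : MemLp a' 2 μ)
    (hb : MemLp b 2 μ) (h : Tendsto (fun n => eLpNorm (a n - a') 2 μ) atTop (𝓝 0)) :
    Tendsto (fun n => ∫ w, a n w * b w ∂μ) atTop (𝓝 (∫ w, a' w * b w ∂μ)) := by
  have key : ∀ c : Ω → ℝ, ∀ hc : MemLp c 2 μ,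
      ⟪hb.toLp b, hc.toLp c⟫_ℝ = ∫ w, c w * b w ∂μ := fun c hc => by
    rw [L2.inner_def]
    refine integral_congr_ae ?_
    filter_upwards [hb.coeFn_toLp, hc.coeFn_toLp] with w h1 h2
    rw [h1, h2]
    simp
  have h1 := (Lp.tendsto_Lp_iff_tendsto_eLpNorm'' a ha a' ha').2 h
  have h2 := (tendsto_const_nhds (x := hb.toLp b)).inner (𝕜 := ℝ) h1
  rw [key] at h2
  exact h2.congr fun n => key _ _

/-- The finite measures with densities `D⁺` and `D⁻` have the same characteristic functional, hence
coincide. So `D⁺ = D⁻` a.e., and `D` vanishes. -/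
theorem ae_eq_zero_of_forall_integral_mul_cos_sin {W : Type*} [NormedAddCommGroup W]
    [NormedSpace ℝ W] [CompleteSpace W] [SecondCountableTopology W] [MeasurableSpace W]
    [BorelSpace W] {μ : Measure W} [IsFiniteMeasure μ] {D : W → ℝ} (hD : Integrable D μ)
    (hcos : ∀ ψ : StrongDual ℝ W, ∫ w, D w * Real.cos (ψ w) ∂μ = 0)
    (hsin : ∀ ψ : StrongDual ℝ W, ∫ w, D w * Real.sin (ψ w) ∂μ = 0) : D =ᵐ[μ] 0 := by
  obtain ⟨D', hD'm, hDD'⟩ := hD.1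
  have hD' : Integrable D' μ := hD.congr hDD'
  have hm : Measurable D' := hD'm.measurable
  have hfin1 := isFiniteMeasure_withDensity_ofReal hD'.hasFiniteIntegral
  have hfin2 := isFiniteMeasure_withDensity_ofReal hD'.neg.hasFiniteIntegral
  have heq : μ.withDensity (fun w => ENNReal.ofReal (D' w)) =
      μ.withDensity (fun w => ENNReal.ofReal ((-D') w)) := by
    refine Measure.ext_of_charFunDual ?_
    ext ψ
    have hpos : ∀ f : W → ℝ, Measurable f → Integrable f μ →
        Integrable (fun w => (ENNReal.ofReal (f w)).toReal • Complex.exp (ψ w * Complex.I)) μ := by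
      intro f hf hfi
      refine hfi.norm.mono' (by fun_prop) (ae_of_all _ fun w => ?_)
      rw [norm_smul, Complex.norm_exp_ofReal_mul_I, mul_one, ENNReal.toReal_ofReal',
        Real.norm_of_nonneg (le_max_right _ _)]
      exact max_le (le_abs_self _) (abs_nonneg _)
    rw [charFunDual_apply, charFunDual_apply,
      integral_withDensity_eq_integral_toReal_smul (by fun_prop) (by simp),
      integral_withDensity_eq_integral_toReal_smul (by fun_prop) (by simp), ← sub_eq_zero,
      ← integral_sub (hpos _ hm hD') (hpos _ hm.neg hD'.neg)]
    have hre : ∀ w, (ENNReal.ofReal (D' w)).toReal • Complex.exp (ψ w * Complex.I) -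
        (ENNReal.ofReal ((-D') w)).toReal • Complex.exp (ψ w * Complex.I) =
        ((D' w * Real.cos (ψ w) : ℝ) : ℂ) + ((D' w * Real.sin (ψ w) : ℝ) : ℂ) * Complex.I := by
      intro w
      rw [← sub_smul, ENNReal.toReal_ofReal', ENNReal.toReal_ofReal', Pi.neg_apply,
        max_zero_sub_eq_self, Complex.exp_mul_I, Complex.real_smul]
      push_cast
      ring
    simp_rw [hre]
    have hi : ∀ f : ℝ → ℝ, Continuous f → (∀ x, |f x| ≤ 1) →
        Integrable (fun w => D' w * f (ψ w)) μ := fun f hf hb =>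
      hD'.mul_bdd (c := 1) (by fun_prop) (ae_of_all _ fun w => hb _)
    rw [integral_add (hi _ Real.continuous_cos Real.abs_cos_le_one).ofReal
      ((hi _ Real.continuous_sin Real.abs_sin_le_one).ofReal.mul_const _), integral_mul_const,
      integral_complex_ofReal, integral_complex_ofReal]
    have h1 : ∫ w, D' w * Real.cos (ψ w) ∂μ = 0 := by
      rw [← hcos ψ]
      exact integral_congr_ae (hDD'.mono fun w hw => by simp only [hw])
    have h2 : ∫ w, D' w * Real.sin (ψ w) ∂μ = 0 := by
      rw [← hsin ψ]
      exact integral_congr_ae (hDD'.mono fun w hw => by simp only [hw])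
    rw [h1, h2]
    simp
  rw [withDensity_eq_iff_of_sigmaFinite (by fun_prop) (by fun_prop)] at heq
  filter_upwards [hDD', heq] with w h1 h2
  rw [h1, Pi.zero_apply]
  have h3 := congrArg ENNReal.toReal h2
  rw [ENNReal.toReal_ofReal', ENNReal.toReal_ofReal', Pi.neg_apply] at h3
  have := max_zero_sub_eq_self (D' w)
  linarith

namespace AbstractWienerSpace

variable {W H : Type*} [NormedAddCommGroup W] [NormedSpace ℝ W] [MeasurableSpace W] [BorelSpace W]
  [NormedAddCommGroup H] [InnerProductSpace ℝ H] [CompleteSpace H]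

/-- Integration by parts on Wiener space. -/
theorem integral_fderiv_delta (A : AbstractWienerSpace W H) {ι : Type*} [Fintype ι] (h : ι → H)
    {k : H} (hk : ‖k‖ = 1) {f : (ι → ℝ) → ℝ} (hf : ContDiff ℝ 1 f)
    (h0 : Integrable (fun w => f fun i => A.delta (h i) w) A.μ)
    (h1 : Integrable (fun w => fderiv ℝ f (fun i => A.delta (h i) w) fun i => ⟪h i, k⟫_ℝ) A.μ)
    (h2 : Integrable (fun w => A.delta k w * f fun i => A.delta (h i) w) A.μ) :
    ∫ w, fderiv ℝ f (fun i => A.delta (h i) w) (fun i => ⟪h i, k⟫_ℝ) ∂A.μ =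
      ∫ w, A.delta k w * f (fun i => A.delta (h i) w) ∂A.μ := by
  set c : ι → ℝ := fun i => ⟪h i, k⟫_ℝ with hc
  -- The parts of the `h i` orthogonal to `k`. The Gaussian vector thus becomes `δ(k) c + Y` with
  -- `Y` independent of `δ(k)`, and the one-dimensional identity applies for fixed `Y`.
  let Y : W → ι → ℝ := fun w i => A.delta (h i - c i • k) w
  have hYm : Measurable Y := measurable_pi_lambda _ fun i => A.measurable_delta _
  have hXm := A.measurable_delta k
  have hZm : Measurable fun w => (A.delta k w, Y w) := hXm.prodMk hYm
  have hind : IndepFun (A.delta k) Y A.μ :=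
    (A.indepFun_delta_of_inner_eq_zero (fun _ : Unit => k) (fun i => h i - c i • k) fun _ i => by
      rw [inner_sub_right, inner_smul_right, real_inner_self_eq_norm_sq, hk, real_inner_comm]
      simp [c]).comp (measurable_pi_apply ()) measurable_id
  have hmap := (indepFun_iff_map_prod_eq_prod_map_map hXm.aemeasurable hYm.aemeasurable).1 hind
  have hk' : ‖k‖₊ ^ 2 = 1 := by
    rw [← NNReal.coe_inj]
    push_cast
    rw [hk, one_pow]
  rw [A.map_delta, hk'] at hmap
  have hprob := Measure.isProbabilityMeasure_map (μ := A.μ) hYm.aemeasurable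
  have hfc : Continuous f := hf.continuous
  have hfd : Continuous (fun y => fderiv ℝ f y c) :=
    (hf.continuous_fderiv one_ne_zero).clm_apply continuous_const
  have hdec : ∀ᵐ w ∂A.μ, (fun i => A.delta (h i) w) = A.delta k w • c + Y w := by
    filter_upwards [ae_all_iff.2 fun i => A.delta_add (c i • k) (h i - c i • k),
      ae_all_iff.2 fun i => A.delta_smul (c i) k] with w hw1 hw2
    ext i
    have h3 := hw1 i
    rw [add_sub_cancel, hw2] at h3
    rw [h3, Pi.add_apply, Pi.smul_apply, smul_eq_mul, mul_comm]
  have hm0 : Continuous fun z : ℝ × (ι → ℝ) => f (z.1 • c + z.2) := by fun_prop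
  have hm1 : Continuous fun z : ℝ × (ι → ℝ) => fderiv ℝ f (z.1 • c + z.2) c :=
    hfd.comp (f := fun z : ℝ × (ι → ℝ) => z.1 • c + z.2) (by fun_prop)
  have hm2 : Continuous fun z : ℝ × (ι → ℝ) => z.1 * f (z.1 • c + z.2) := by fun_prop
  have key := integral_fderiv_gaussianReal_prod (hf.differentiable one_ne_zero) c
    (ν := A.μ.map Y) ?_ ?_ ?_
  · rw [← hmap, integral_map hZm.aemeasurable hm1.aestronglyMeasurable,
      integral_map hZm.aemeasurable hm2.aestronglyMeasurable] at key
    refine ((integral_congr_ae ?_).trans key).trans (integral_congr_ae ?_)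
    · filter_upwards [hdec] with w hw
      rw [hw]
    · filter_upwards [hdec] with w hw
      rw [hw]
  · rw [← hmap, integrable_map_measure hm0.aestronglyMeasurable hZm.aemeasurable]
    refine h0.congr ?_
    filter_upwards [hdec] with w hw
    rw [hw, Function.comp_apply]
  · rw [← hmap, integrable_map_measure hm1.aestronglyMeasurable hZm.aemeasurable]
    refine h1.congr ?_
    filter_upwards [hdec] with w hw
    rw [hw, Function.comp_apply]
  · rw [← hmap, integrable_map_measure hm2.aestronglyMeasurable hZm.aemeasurable]
    refine h2.congr ?_
    filter_upwards [hdec] with w hw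
    rw [hw, Function.comp_apply]

theorem memLp_delta_pi (A : AbstractWienerSpace W H) {ι : Type*} [Fintype ι] (h : ι → H)
    (p : ℝ≥0∞) (hp : p ≠ ∞) : MemLp (fun w i => A.delta (h i) w) p A.μ :=
  (A.hasGaussianLaw_delta_pi h).memLp hp

theorem memLp_temperate_delta (A : AbstractWienerSpace W H) {ι : Type*} [Fintype ι] (h : ι → H)
    {f : (ι → ℝ) → ℝ} (hf : f.HasTemperateGrowth) :
    MemLp (fun w => f fun i => A.delta (h i) w) 2 A.μ := by
  obtain ⟨k, C, hC⟩ := hf.2 0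
  simp only [norm_iteratedFDeriv_zero] at hC
  exact memLp_two_comp_of_norm_le_pow (A.memLp_delta_pi h) hf.1.continuous hC

theorem memLp_fderiv_temperate_delta (A : AbstractWienerSpace W H) {ι : Type*} [Fintype ι]
    (h : ι → H) {f : (ι → ℝ) → ℝ} (hf : f.HasTemperateGrowth) (c : ι → ℝ) :
    MemLp (fun w => fderiv ℝ f (fun i => A.delta (h i) w) c) 2 A.μ := by
  obtain ⟨k, C, hC⟩ := hf.2 1
  simp only [norm_iteratedFDeriv_one] at hC
  refine memLp_two_comp_of_norm_le_pow (f := fun y => fderiv ℝ f y c) (C := C * ‖c‖) (k := k)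
    (A.memLp_delta_pi h)
    ((hf.1.continuous_fderiv (by simp)).clm_apply continuous_const) fun x => ?_
  refine ((fderiv ℝ f x).le_opNorm c).trans ?_
  rw [mul_right_comm]
  exact mul_le_mul_of_nonneg_right (hC x) (norm_nonneg c)

/-- Integration by parts against a bounded function of one further Gaussian variable. -/
theorem integral_fderiv_delta_mul (A : AbstractWienerSpace W H) {ι : Type*} [Fintype ι]
    (h : ι → H) {k : H} (hk : ‖k‖ = 1) {f : (ι → ℝ) → ℝ} (hf : f.HasTemperateGrowth)
    {g : ℝ → ℝ} (hg : ContDiff ℝ 1 g) (hg1 : ∀ x, |g x| ≤ 1) (hg2 : ∀ x, |deriv g x| ≤ 1) (p : H) :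
    ∫ w, fderiv ℝ f (fun i => A.delta (h i) w) (fun i => ⟪h i, k⟫_ℝ) * g (A.delta p w) ∂A.μ =
      ∫ w, f (fun i => A.delta (h i) w) *
        (A.delta k w * g (A.delta p w) - deriv g (A.delta p w) * ⟪p, k⟫_ℝ) ∂A.μ := by
  -- The test function becomes part of the integrand: `p` is added as the coordinate `none`, and the
  -- product rule produces the term with `deriv g`.
  let h' : Option ι → H := fun o => o.elim p h
  let R : (Option ι → ℝ) →L[ℝ] (ι → ℝ) := ContinuousLinearMap.pi fun i =>
    ContinuousLinearMap.proj (some i)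
  let E : (Option ι → ℝ) →L[ℝ] ℝ := ContinuousLinearMap.proj none
  let φ : (Option ι → ℝ) → ℝ := fun y => f (R y) * g (E y)
  have hf1 : ContDiff ℝ 1 f := hf.1.of_le (by simp)
  have hφ : ContDiff ℝ 1 φ := (hf1.comp R.contDiff).mul (hg.comp E.contDiff)
  have hfd := hf1.differentiable one_ne_zero
  have hgd := hg.differentiable one_ne_zero
  have hφd : ∀ y c, fderiv ℝ φ y c =
      fderiv ℝ f (R y) (R c) * g (E y) + f (R y) * (deriv g (E y) * E c) := fun y c => by
    have e1 : HasFDerivAt (fun y => f (R y)) ((fderiv ℝ f (R y)).comp R) y :=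
      (hfd (R y)).hasFDerivAt.comp y R.hasFDerivAt
    have e2 : HasFDerivAt (fun y => g (E y)) (deriv g (E y) • E) y :=
      (hgd (E y)).hasDerivAt.comp_hasFDerivAt y E.hasFDerivAt
    have e3 : HasFDerivAt φ _ y := e1.mul e2
    rw [e3.fderiv]
    simp only [add_apply, smul_apply, ContinuousLinearMap.comp_apply, smul_eq_mul]
    ring
  have hdm := A.measurable_delta p
  have hgm : Measurable fun w => g (A.delta p w) := hg.continuous.measurable.comp hdm
  have hgm' : Measurable fun w => deriv g (A.delta p w) :=
    (hg.continuous_deriv le_rfl).measurable.comp hdm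
  have L0 := A.memLp_temperate_delta h hf
  have L1 := A.memLp_fderiv_temperate_delta h hf (fun i => ⟪h i, k⟫_ℝ)
  have i0 : Integrable (fun w => f (fun i => A.delta (h i) w) * g (A.delta p w)) A.μ :=
    (L0.integrable (by norm_num)).mul_bdd (c := 1) hgm.aestronglyMeasurable
      (ae_of_all _ fun _ => hg1 _)
  have i1 : Integrable (fun w => fderiv ℝ f (fun i => A.delta (h i) w) (fun i => ⟪h i, k⟫_ℝ) *
      g (A.delta p w)) A.μ :=
    (L1.integrable (by norm_num)).mul_bdd (c := 1) hgm.aestronglyMeasurable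
      (ae_of_all _ fun _ => hg1 _)
  have i2 : Integrable (fun w => f (fun i => A.delta (h i) w) *
      (deriv g (A.delta p w) * ⟪p, k⟫_ℝ)) A.μ := by
    simp_rw [← mul_assoc]
    exact ((L0.integrable (by norm_num)).mul_bdd (c := 1) hgm'.aestronglyMeasurable
      (ae_of_all _ fun _ => hg2 _)).mul_const _
  have i3 : Integrable (fun w => A.delta k w *
      (f (fun i => A.delta (h i) w) * g (A.delta p w))) A.μ := by
    simp_rw [← mul_assoc]
    exact ((A.memLp_delta k).integrable_mul L0).mul_bdd (c := 1) hgm.aestronglyMeasurable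
      (ae_of_all _ fun _ => hg1 _)
  have hval : ∀ w, φ (fun o => A.delta (h' o) w) =
      f (fun i => A.delta (h i) w) * g (A.delta p w) := fun w => rfl
  have hder : ∀ w, fderiv ℝ φ (fun o => A.delta (h' o) w) (fun o => ⟪h' o, k⟫_ℝ) =
      fderiv ℝ f (fun i => A.delta (h i) w) (fun i => ⟪h i, k⟫_ℝ) * g (A.delta p w) +
        f (fun i => A.delta (h i) w) * (deriv g (A.delta p w) * ⟪p, k⟫_ℝ) := fun w => hφd _ _
  have key := A.integral_fderiv_delta h' hk hφ
    (by simp_rw [hval]; exact i0) (by simp_rw [hder]; exact i1.add i2)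
    (by simp_rw [hval]; exact i3)
  simp_rw [hval, hder] at key
  rw [integral_add i1 i2, ← eq_sub_iff_add_eq, ← integral_sub i3 i2] at key
  rw [key]
  congr 1
  ext w
  ring

end AbstractWienerSpace

end

/-! ### Closability: uniqueness of the gradient -/

noncomputable section

theorem enorm_sq_le_hsNormSq {H X : Type*} [NormedAddCommGroup H] [InnerProductSpace ℝ H]
    [NormedAddCommGroup X] [InnerProductSpace ℝ X] (T : H →L[ℝ] X) {k : H} (hk : ‖k‖ = 1) :
    ‖T k‖ₑ ^ 2 ≤ hsNormSq T := by
  have ho : Orthonormal ℝ (fun x : ({k} : Finset H) => (x : H)) := by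
    refine ⟨fun x => ?_, fun x y hxy => ?_⟩
    · change ‖(x : H)‖ = 1
      rw [Finset.mem_singleton.1 x.2, hk]
    · exact absurd (Subtype.ext ((Finset.mem_singleton.1 x.2).trans
        (Finset.mem_singleton.1 y.2).symm)) hxy
  refine le_iSup₂_of_le {k} ho ?_
  rw [Finset.sum_singleton]

namespace SmoothCylinder

variable {H X : Type*} [NormedAddCommGroup X] [InnerProductSpace ℝ X]

/-- The function of the Gaussian coordinates representing the inner product of a smooth cylindrical
functional with `x`. -/
def innerCoeff (F : SmoothCylinder H X) (x : X) (y : Fin F.n → ℝ) : ℝ :=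
  ∑ j, F.coeff j y * ⟪F.vec j, x⟫_ℝ

theorem hasTemperateGrowth_innerCoeff (F : SmoothCylinder H X) (x : X) :
    (F.innerCoeff x).HasTemperateGrowth :=
  Function.HasTemperateGrowth.sum fun j _ =>
    (F.temperate j).mul (Function.HasTemperateGrowth.const _)

theorem fderiv_innerCoeff (F : SmoothCylinder H X) (x : X) (y c : Fin F.n → ℝ) :
    fderiv ℝ (F.innerCoeff x) y c = ∑ j, fderiv ℝ (F.coeff j) y c * ⟪F.vec j, x⟫_ℝ := by
  have h : HasFDerivAt (F.innerCoeff x)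
      (∑ j, ⟪F.vec j, x⟫_ℝ • fderiv ℝ (F.coeff j) y) y :=
    HasFDerivAt.fun_sum fun j _ =>
      (((F.temperate j).1.differentiable (by simp)) y).hasFDerivAt.mul_const _
  rw [h.fderiv, sum_apply]
  exact Finset.sum_congr rfl fun j _ => mul_comm _ _

end SmoothCylinder

namespace AbstractWienerSpace

variable {W H : Type*} [NormedAddCommGroup W] [NormedSpace ℝ W] [MeasurableSpace W] [BorelSpace W]
  [NormedAddCommGroup H] [InnerProductSpace ℝ H] [CompleteSpace H]

section Gradient

variable {X : Type*} [NormedAddCommGroup X] [InnerProductSpace ℝ X]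

theorem inner_cylinderEval (A : AbstractWienerSpace W H) (F : SmoothCylinder H X) (x : X) (w : W) :
    ⟪A.cylinderEval F w, x⟫_ℝ = F.innerCoeff x (fun i => A.delta (F.dir i) w) := by
  rw [cylinderEval, sum_inner]
  exact Finset.sum_congr rfl fun j _ => real_inner_smul_left _ _ _

theorem inner_cylinderGrad (A : AbstractWienerSpace W H) (F : SmoothCylinder H X) (x : X) (k : H)
    (w : W) : ⟪A.cylinderGrad F w k, x⟫_ℝ =
      fderiv ℝ (F.innerCoeff x) (fun i => A.delta (F.dir i) w) (fun i => ⟪F.dir i, k⟫_ℝ) := by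
  rw [cylinderGrad_apply, sum_inner, F.fderiv_innerCoeff]
  exact Finset.sum_congr rfl fun j _ => real_inner_smul_left _ _ _

theorem IsGradient.memLp_inner {A : AbstractWienerSpace W H} {u : W → X} {G : W → H →L[ℝ] X}
    (hu : A.IsGradient u G) {k : H} (hk : ‖k‖ = 1) (x : X) :
    MemLp (fun w => ⟪G w k, x⟫_ℝ) 2 A.μ := by
  have h1 : MemLp (fun w => G w k) 2 A.μ := by
    refine ⟨hu.aestronglyMeasurable k, ?_⟩
    rw [eLpNorm_eq_lintegral_rpow_enorm_toReal two_ne_zero ENNReal.ofNat_ne_top]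
    refine ENNReal.rpow_lt_top_of_nonneg (by norm_num) (ne_top_of_le_ne_top
      hu.lintegral_lt_top.ne (lintegral_mono fun w => ?_))
    rw [ENNReal.toReal_ofNat, ENNReal.rpow_two]
    exact enorm_sq_le_hsNormSq _ hk
  exact h1.inner_const x

/-- The integration by parts that characterises the gradient. -/
theorem IsGradient.integral_inner_mul {A : AbstractWienerSpace W H} {u : W → X}
    {G : W → H →L[ℝ] X} (hu : A.IsGradient u G) {k : H} (hk : ‖k‖ = 1) {x : X} (hx : ‖x‖ = 1)
    {g : ℝ → ℝ} (hg : ContDiff ℝ 1 g) (hg1 : ∀ x, |g x| ≤ 1) (hg2 : ∀ x, |deriv g x| ≤ 1) (p : H) :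
    ∫ w, ⟪G w k, x⟫_ℝ * g (A.delta p w) ∂A.μ = ∫ w, ⟪u w, x⟫_ℝ *
      (A.delta k w * g (A.delta p w) - deriv g (A.delta p w) * ⟪p, k⟫_ℝ) ∂A.μ := by
  obtain ⟨F, hF1, hF2⟩ := hu.exists_approx
  have hgm : AEStronglyMeasurable (fun w => g (A.delta p w)) A.μ :=
    (hg.continuous.measurable.comp (A.measurable_delta p)).aestronglyMeasurable
  have hgm' : AEStronglyMeasurable (fun w => deriv g (A.delta p w)) A.μ :=
    ((hg.continuous_deriv le_rfl).measurable.comp (A.measurable_delta p)).aestronglyMeasurable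
  have hb0 : MemLp (fun w => g (A.delta p w)) 2 A.μ :=
    MemLp.of_bound hgm 1 (ae_of_all _ fun _ => hg1 _)
  have hb1 : MemLp (fun w => A.delta k w * g (A.delta p w) -
      deriv g (A.delta p w) * ⟪p, k⟫_ℝ) 2 A.μ := by
    refine MemLp.sub ?_ ?_
    · refine (A.memLp_delta k).of_le ((A.memLp_delta k).1.mul hgm) (ae_of_all _ fun w => ?_)
      rw [norm_mul]
      exact mul_le_of_le_one_right (norm_nonneg _) (hg1 _)
    · exact (MemLp.of_bound hgm' 1 (ae_of_all _ fun _ => hg2 _)).mul_const _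
  -- Both sides of the cylindrical identity are `L²` pairings with fixed functions, so they pass to
  -- the limit. On this side the operator applied to the unit vector `k` is bounded by its
  -- Hilbert–Schmidt norm.
  have hl := tendsto_integral_mul_of_tendsto_eLpNorm
    (a := fun n w => ⟪A.cylinderGrad (F n) w k, x⟫_ℝ) (a' := fun w => ⟪G w k, x⟫_ℝ)
    (fun n => by
      simp_rw [inner_cylinderGrad]
      exact A.memLp_fderiv_temperate_delta _ ((F n).hasTemperateGrowth_innerCoeff x) _)
    (hu.memLp_inner hk x) hb0 (by
      have h0 := hF2.ennrpow_const (1 / 2)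
      rw [ENNReal.zero_rpow_of_pos (by norm_num)] at h0
      refine tendsto_of_tendsto_of_tendsto_of_le_of_le tendsto_const_nhds h0 (fun _ => zero_le)
        fun n => ?_
      rw [eLpNorm_eq_lintegral_rpow_enorm_toReal two_ne_zero ENNReal.ofNat_ne_top,
        ENNReal.toReal_ofNat]
      refine ENNReal.rpow_le_rpow (lintegral_mono fun w => ?_) (by norm_num)
      rw [ENNReal.rpow_two, Pi.sub_apply, ← inner_sub_left, ← sub_apply]
      refine le_trans (pow_le_pow_left₀ zero_le ?_ 2) (enorm_sq_le_hsNormSq _ hk)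
      refine enorm_le_iff_norm_le.2 ((norm_inner_le_norm _ _).trans_eq ?_)
      rw [hx, mul_one])
  have hr := tendsto_integral_mul_of_tendsto_eLpNorm
    (a := fun n w => ⟪A.cylinderEval (F n) w, x⟫_ℝ) (a' := fun w => ⟪u w, x⟫_ℝ)
    (fun n => by
      simp_rw [inner_cylinderEval]
      exact A.memLp_temperate_delta _ ((F n).hasTemperateGrowth_innerCoeff x))
    (hu.memLp.inner_const x) hb1 (by
      refine tendsto_of_tendsto_of_tendsto_of_le_of_le tendsto_const_nhds hF1 (fun _ => zero_le)
        fun n => ?_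
      refine eLpNorm_mono fun w => ?_
      rw [Pi.sub_apply, ← inner_sub_left]
      refine (norm_inner_le_norm _ _).trans_eq ?_
      rw [hx, mul_one])
  refine tendsto_nhds_unique hl (hr.congr fun n => ?_)
  simp_rw [inner_cylinderGrad, inner_cylinderEval]
  exact (A.integral_fderiv_delta_mul _ hk ((F n).hasTemperateGrowth_innerCoeff x) hg hg1 hg2 p).symm

/-- The gradient operator on smooth cylindrical functionals is closable. -/
theorem IsGradient.inner_ae_eq [CompleteSpace W] [SecondCountableTopology W]
    {A : AbstractWienerSpace W H} {u : W → X} {G G' : W → H →L[ℝ] X} (hG : A.IsGradient u G)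
    (hG' : A.IsGradient u G') {k : H} (hk : ‖k‖ = 1) {x : X} (hx : ‖x‖ = 1) :
    ∀ᵐ w ∂A.μ, ⟪G w k, x⟫_ℝ = ⟪G' w k, x⟫_ℝ := by
  have i1 := (hG.memLp_inner hk x).integrable (by norm_num)
  have i2 := (hG'.memLp_inner hk x).integrable (by norm_num)
  -- The right side of the integration by parts involves only `u`, so it is common to `G` and `G'`.
  -- The choice `p = dualToH ψ` makes `δ(p)` equal to `ψ` a.s.
  have key : ∀ g : ℝ → ℝ, ContDiff ℝ 1 g → (∀ x, |g x| ≤ 1) → (∀ x, |deriv g x| ≤ 1) →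
      ∀ ψ : StrongDual ℝ W, ∫ w, (⟪G w k, x⟫_ℝ - ⟪G' w k, x⟫_ℝ) * g (ψ w) ∂A.μ = 0 := by
    intro g hg hg1 hg2 ψ
    have hgm : AEStronglyMeasurable (fun w => g (ψ w)) A.μ :=
      (hg.continuous.comp ψ.continuous).aestronglyMeasurable
    have h1 := hG.integral_inner_mul hk hx hg hg1 hg2 (A.dualToH ψ)
    rw [← hG'.integral_inner_mul hk hx hg hg1 hg2 (A.dualToH ψ)] at h1
    have h2 : ∀ f : W → ℝ, ∫ w, f w * g (A.delta (A.dualToH ψ) w) ∂A.μ =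
        ∫ w, f w * g (ψ w) ∂A.μ := fun f => by
      refine integral_congr_ae ?_
      filter_upwards [A.delta_dualToH ψ] with w hw
      rw [hw]
    rw [h2, h2] at h1
    simp_rw [sub_mul]
    rw [integral_sub, h1, sub_self]
    · exact i1.mul_bdd (c := 1) hgm (ae_of_all _ fun _ => hg1 _)
    · exact i2.mul_bdd (c := 1) hgm (ae_of_all _ fun _ => hg1 _)
  have h0 := ae_eq_zero_of_forall_integral_mul_cos_sin (i1.sub i2)
    (key Real.cos Real.contDiff_cos Real.abs_cos_le_one fun x => by
      rw [Real.deriv_cos, abs_neg]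
      exact Real.abs_sin_le_one x)
    (key Real.sin Real.contDiff_sin Real.abs_sin_le_one fun x => by
      rw [Real.deriv_sin]
      exact Real.abs_cos_le_one x)
  filter_upwards [h0] with w hw
  exact sub_eq_zero.1 hw

end Gradient

/-- Countably many matrix coefficients agree off one null set, and they determine a bounded
operator. -/
theorem IsGradient.ae_eq [CompleteSpace W] [SecondCountableTopology W]
    {A : AbstractWienerSpace W H} (e : HilbertBasis ℕ ℝ H) {u : W → H} {G G' : W → H →L[ℝ] H}
    (hG : A.IsGradient u G) (hG' : A.IsGradient u G') : G =ᵐ[A.μ] G' := by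
  filter_upwards [ae_all_iff.2 fun i => ae_all_iff.2 fun j =>
    hG.inner_ae_eq hG' (e.norm_apply i) (e.norm_apply j)] with w hw
  refine ContinuousLinearMap.ext_on (s := Set.range e) ?_ ?_
  · have := e.dense_span
    rwa [← Submodule.dense_iff_topologicalClosure_eq_top] at this
  · rintro _ ⟨i, rfl⟩
    refine e.repr.injective ?_
    ext j
    rw [e.repr_apply_apply, e.repr_apply_apply, real_inner_comm, hw i j, real_inner_comm]

end AbstractWienerSpace

end

theorem mainTheorem6 {W H : Type*}
    [NormedAddCommGroup W] [NormedSpace ℝ W] [CompleteSpace W] [TopologicalSpace.SeparableSpace W]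
    [MeasurableSpace W] [BorelSpace W]
    [NormedAddCommGroup H] [InnerProductSpace ℝ H] [CompleteSpace H]
    (A : AbstractWienerSpace W H) (e : HilbertBasis ℕ ℝ H) (α : ℝ) (hα : 0 < α) :
    -- the series defining `u` converges almost surely in `H`
    (∀ᵐ w ∂A.μ, Summable fun i : ℕ =>
      ((2 : ℝ) ^ (-((i : ℝ) + 1) * α) * A.delta (e (i + 1)) w) • e i) ∧
    A.MemD21 (A.shiftField e α) ∧
    -- `∇u` is almost surely the weighted shift `h ↦ ∑ 2^{-iα} (e_{i+1}, h) e_i`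
    (∀ G : W → H →L[ℝ] H, A.IsGradient (A.shiftField e α) G → ∀ᵐ w ∂A.μ, ∀ h : H,
      HasSum (fun i : ℕ => ((2 : ℝ) ^ (-((i : ℝ) + 1) * α) * ⟪e (i + 1), h⟫_ℝ) • e i) (G w h)) ∧
    A.HasQuasinilpotentGradient (A.shiftField e α) ∧
    (¬ ∃ π : ContinuousResolution H, A.IsAdapted π (A.shiftField e α)) ∧
    -- hence the converse of "adapted implies quasinilpotent gradient" fails
    ¬ (∀ v : W → H, A.MemD21 v → A.HasQuasinilpotentGradient v →
      ∃ π : ContinuousResolution H, A.IsAdapted π v) := by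
  have : SecondCountableTopology W := UniformSpace.secondCountable_of_separable W
  have hq0 : 0 < (2 : ℝ) ^ (-α) := by positivity
  have hq1 := AbstractWienerSpace.two_rpow_neg_lt_one hα
  have hgrad := A.isGradient_shiftField e hα
  -- An arbitrary version of the gradient is first identified with the deterministic shift.
  have hquasi : A.HasQuasinilpotentGradient (A.shiftField e α) := fun G hG => by
    filter_upwards [hG.ae_eq e hgrad] with w hw
    rw [hw]
    exact isQuasinilpotent_backwardShift e hq0 hq1
  have hnot : ¬ ∃ π : ContinuousResolution H, A.IsAdapted π (A.shiftField e α) :=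
    fun ⟨π, hπ⟩ => A.not_isAdapted_shiftField π e hα hπ
  refine ⟨?_, ⟨_, hgrad⟩, fun G hG => ?_, hquasi, hnot, fun h => hnot (h _ ⟨_, hgrad⟩ hquasi)⟩
  · simp_rw [two_rpow_weight]
    filter_upwards [A.ae_hasSum_shiftField e hα] with w hw
    exact hw.summable
  · simp_rw [two_rpow_weight]
    filter_upwards [hG.ae_eq e hgrad] with w hw h
    rw [hw]
    exact e.hasSum_backwardShift hq0 hq1 h
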